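/- Let $\eta,\nu>0$ and let $k,\ell\in L_{1,loc}([0,\infty))$ be real functions such that $k$ is nonnegative and nonincreasing on $(0,\infty)$ and $k*\ell=1$ on $(0,\infty)$ (that is, $(k,\ell)\in(\mathcal{PC})$), where $(f*g)(t)=\int_0^t f(t-s)g(s)\,ds$ and equations between locally integrable functions are understood almost everywhere. Let $r_\eta\in L_{1,loc}([0,\infty))$ be the solution of $r_\eta+\eta\,(r_\eta*\ell)=\ell$ on $(0,\infty)$, and set $$V(t)=2\nu\,(1*\ell*r_\eta)(t),\quad t>0.$$ Write $\widehat{\ell}(\lambda)=\int_0^\infty e^{-\lambda t}\ell(t)\,dt$, and call $L:(0,\infty)\to(0,\infty)$ regularly varying of index $\varrho\in\mathbb{R}$ if $\lim_{t\to\infty}L(tx)/L(t)=x^{\varrho}$ for every $x>0$. A function $U$ on $(0,\infty)\times\mathbb{R}$ with $U(t,\cdot)\in L_1(\mathbb{R})$ for all $t>0$ is called a fundamental solution of $$\partial_t^2\bigl(k*k*(u-u_0)\bigr)+\eta\,\partial_t\bigl(k*(u-u_0)\bigr)-\nu\,\partial_z^2u=0,\quad t>0,\ z\in\mathbb{R},\qquad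 u_0=\delta_0,$$ if for each $\varphi\in C_c^\infty(\mathbb{R})$ the function $m_\varphi(t)=\int_{\mathbb{R}}\varphi(z)U(t,z)\,dz$ is continuous on $(0,\infty)$, $m_\varphi(t)\to\varphi(0)$ as $t\to0^+$, and, with $w_\varphi=m_\varphi-\varphi(0)$, $$k*k*w_\varphi+\eta\,(1*k*w_\varphi)=\nu\,(1*1*m_{\varphi''})\quad\text{on }(0,\infty).$$ Then: 1. If $(X(t))_{t>0}$ are real random variables on a probability space such that $X(t)$ has density $U(t,\cdot)$ for every $t>0$, where $U$ is a fundamental solution, then $X(t)$ is square integrable and $\mathrm{Var}[X(t)]=V(t)$ for all $t>0$. 2. If $\widehat{\ell}$ is regularly varying of index $\varrho_1<\tfrac12$, then $$V(t)\sim\frac{2\nu}{\Gamma(1-2\varrho_1)}\bigl(\widehat{\ell}(t^{-1})\bigr)^2\quad\text{as }t\to0^+.$$ 3. If $t\mapsto\widehat{\ell}(t^{-1})$ is regularly varying of index $\varrho_2>-1$ and $\ell\notin L_1((0,\infty))$, then $$V(t)\sim\frac{2\nu}{\eta\,\Gamma(1+\varrho_2)}\,\widehat{\ell}(t^{-1})\quad\text{as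 }t\to\infty.$$ Here $f\sim g$ means $f/g\to1$. By part 1, the asymptotics in parts 2 and 3 are those of $\mathrm{Var}[X(t)]$. -/

import Mathlib

open MeasureTheory ProbabilityTheory Set Filter Topology Asymptotics
open scoped ContDiff

noncomputable section

/-- The convolution `(f ∗ g)(t) = ∫₀ᵗ f (t - s) g s ds` of functions on the half-line
(only the values on `(0, ∞)` matter). -/
def halfConv (f g : ℝ → ℝ) (t : ℝ) : ℝ := ∫ s in (0 : ℝ)..t, f (t - s) * g s

/-- The Laplace transform `∫₀^∞ exp (-l t) f t dt` of a function on the half-line. -/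
def halfLaplace (f : ℝ → ℝ) (l : ℝ) : ℝ := ∫ t in Ioi (0 : ℝ), Real.exp (-l * t) * f t

/-- `(k, ℓ) ∈ (PC)`: both kernels are in `L¹_loc` of the closed half-line, `k` is nonnegative and
nonincreasing on `(0, ∞)`, and `k ∗ ℓ = 1` on `(0, ∞)` (as elements of `L¹_loc`, i.e. almost
everywhere). -/
structure IsPC (k ℓ : ℝ → ℝ) : Prop where
  locallyIntegrable_left : LocallyIntegrableOn k (Ici 0)
  nonneg : ∀ t, 0 < t → 0 ≤ k t
  antitone : AntitoneOn k (Ioi 0)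
  locallyIntegrable_right : LocallyIntegrableOn ℓ (Ici 0)
  conv_eq_one : ∀ᵐ t ∂(volume.restrict (Ioi (0 : ℝ))), halfConv k ℓ t = 1

/-- `r` is the integral scalar resolvent associated to `ℓ`: the locally integrable solution of
`r + η (r ∗ ℓ) = ℓ` on `(0, ∞)`, the equation being understood in `L¹_loc`. -/
structure IsIntegralResolvent (η : ℝ) (ℓ r : ℝ → ℝ) : Prop where
  locallyIntegrable : LocallyIntegrableOn r (Ici 0)
  equation : ∀ᵐ t ∂(volume.restrict (Ioi (0 : ℝ))), r t + η * halfConv r ℓ t = ℓ t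

/-- `L : (0, ∞) → (0, ∞)` is regularly varying (at infinity) of index `ρ`. -/
def IsRegularlyVarying (L : ℝ → ℝ) (ρ : ℝ) : Prop :=
  (∀ x, 0 < x → 0 < L x) ∧
    ∀ x, 0 < x → Tendsto (fun t => L (t * x) / L t) atTop (𝓝 (x ^ ρ))

/-- The pairing `⟨U(t,·), φ⟩ = ∫ φ(z) U(t,z) dz`. -/
def spacePairing (U : ℝ → ℝ → ℝ) (φ : ℝ → ℝ) (t : ℝ) : ℝ := ∫ z, φ z * U t z

/-- `U` is a fundamental solution of the non-local in time telegraph equation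
`∂ₜ² (k ∗ k ∗ (u - u₀)) + η ∂ₜ (k ∗ (u - u₀)) - ν ∂_z² u = 0` on `t > 0`, `z ∈ ℝ`, with initial
datum `u₀ = δ₀`.

Derivatives in `z` are taken in the sense of distributions: the equation is tested against every
`φ ∈ C_c^∞(ℝ)`. In `t` the equation is integrated twice, with `k ∗ k ∗ (u - u₀)`, its time
derivative and `k ∗ (u - u₀)` vanishing at `t = 0`, which gives
`k ∗ k ∗ w + η (1 ∗ k ∗ w) = ν (1 ∗ 1 ∗ ⟨u, φ''⟩)` for `w(t) = ⟨u(t,·), φ⟩ - φ(0)`.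
The initial condition `u(0,·) = δ₀` is attained in the sense of distributions. -/
structure IsFundamentalSolution (k : ℝ → ℝ) (η ν : ℝ) (U : ℝ → ℝ → ℝ) : Prop where
  integrable : ∀ t, 0 < t → Integrable (U t)
  continuousOn : ∀ φ : ℝ → ℝ, ContDiff ℝ ∞ φ → HasCompactSupport φ →
    ContinuousOn (spacePairing U φ) (Ioi 0)
  initial : ∀ φ : ℝ → ℝ, ContDiff ℝ ∞ φ → HasCompactSupport φ →
    Tendsto (spacePairing U φ) (𝓝[>] 0) (𝓝 (φ 0))
  equation : ∀ φ : ℝ → ℝ, ContDiff ℝ ∞ φ → HasCompactSupport φ → ∀ t, 0 < t →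
    halfConv k (halfConv k (fun s => spacePairing U φ s - φ 0)) t
      + η * halfConv (fun _ => 1) (halfConv k (fun s => spacePairing U φ s - φ 0)) t
      = ν * halfConv (fun _ => 1) (halfConv (fun _ => 1) (spacePairing U (deriv (deriv φ)))) t

/-- For every `t > 0` the random variable `X t` has the probability density `U t`. -/
structure HasDensities {Ω : Type*} [MeasurableSpace Ω] (P : Measure Ω) (X : ℝ → Ω → ℝ)
    (U : ℝ → ℝ → ℝ) : Prop where
  aemeasurable : ∀ t, 0 < t → AEMeasurable (X t) P
  nonneg : ∀ t, 0 < t → ∀ᵐ z, 0 ≤ U t z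
  law : ∀ t, 0 < t → P.map (X t) = volume.withDensity (fun z => ENNReal.ofReal (U t z))

/-- The function `2 ν (1 ∗ ℓ ∗ r)(t)`. -/
def varianceFunction (ν : ℝ) (ℓ r : ℝ → ℝ) (t : ℝ) : ℝ :=
  2 * ν * halfConv (fun _ => 1) (halfConv ℓ r) t

end

noncomputable section

/-- Lebesgue measure on the open half-line. -/
local notation "vol₊" => (volume.restrict (Ioi (0 : ℝ)) : Measure ℝ)

/-- The convolution of real functions on the line. -/
def lineConv (f g : ℝ → ℝ) : ℝ → ℝ :=
  convolution f g (ContinuousLinearMap.mul ℝ ℝ) volume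

/-- `F` vanishes on `(-∞, 0]` and agrees with `f` on `(0, T)`. -/
def ExtendsBelow (T : ℝ) (F f : ℝ → ℝ) : Prop :=
  ∀ s, s ≤ 0 ∨ s < T → F s = (Ioi (0 : ℝ)).indicator f s

theorem halfConv_comm (f g : ℝ → ℝ) (t : ℝ) : halfConv f g t = halfConv g f t := by
  unfold halfConv
  have := intervalIntegral.integral_comp_sub_left (fun s => f s * g (t - s)) t (a := 0) (b := t)
  simp only [sub_sub_cancel, sub_self, sub_zero] at this
  rw [this]
  exact intervalIntegral.integral_congr fun s _ => mul_comm _ _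

theorem halfConv_eq_setIntegral (f g : ℝ → ℝ) {t : ℝ} (ht : 0 ≤ t) :
    halfConv f g t = ∫ s in Ioo 0 t, f (t - s) * g s := by
  rw [halfConv, intervalIntegral.integral_of_le ht, integral_Ioc_eq_integral_Ioo]

theorem ExtendsBelow.lineConv {T : ℝ} {F G f g : ℝ → ℝ} (hF : ExtendsBelow T F f)
    (hG : ExtendsBelow T G g) : ExtendsBelow T (lineConv F G) (halfConv f g) := by
  intro t ht
  unfold _root_.lineConv convolution
  rw [← integral_sub_left_eq_self _ _ t]
  simp only [sub_sub_cancel, ContinuousLinearMap.mul_apply']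
  have key : ∀ s, F (t - s) * G s = (Ioo 0 t).indicator (fun s => f (t - s) * g s) s := by
    intro s
    by_cases h0 : 0 < s
    · by_cases h1 : s < t
      · have htT : t < T := ht.resolve_left (by linarith)
        rw [hF _ (Or.inr (by linarith)), hG _ (Or.inr (by linarith)),
          indicator_of_mem (show t - s ∈ Ioi 0 from
          sub_pos.2 h1), indicator_of_mem (show s ∈ Ioi 0 from h0),
          indicator_of_mem (show s ∈ Ioo 0 t from ⟨h0, h1⟩)]
      · rw [hF _ (Or.inl (by linarith)),
          indicator_of_notMem (show t - s ∉ Ioi 0 by simpa using h1),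
          indicator_of_notMem (show s ∉ Ioo 0 t from fun h => h1 h.2), zero_mul]
    · rw [indicator_of_notMem (show s ∉ Ioo 0 t from fun h => h0 h.1), hG _ (Or.inl (not_lt.1 h0)),
        indicator_of_notMem (show s ∉ Ioi 0 from h0), mul_zero]
  simp_rw [key]
  rw [integral_indicator measurableSet_Ioo]
  by_cases h0 : 0 < t
  · rw [indicator_of_mem (show t ∈ Ioi 0 from h0), halfConv_eq_setIntegral _ _ h0.le]
  · rw [indicator_of_notMem (show t ∉ Ioi 0 from h0), Ioo_eq_empty h0]
    simp

theorem locallyIntegrableOn_Ici_zero_iff {f : ℝ → ℝ} :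
    LocallyIntegrableOn f (Ici 0) ↔ ∀ T, IntegrableOn f (Ioo 0 T) := by
  rw [locallyIntegrableOn_iff isClosed_Ici.isLocallyClosed]
  constructor
  · intro h T
    exact (h (Icc 0 T) Icc_subset_Ici_self isCompact_Icc).mono_set Ioo_subset_Icc_self
  · intro h K hK hKc
    obtain ⟨T, hT⟩ := hKc.bddAbove
    have h1 : IntegrableOn f (Ico 0 (T + 1)) := by
      rw [integrableOn_Ico_iff_integrableOn_Ioo]
      exact h _
    exact h1.mono_set fun x hx => ⟨hK hx, by linarith [hT hx]⟩

theorem exists_extendsBelow {f : ℝ → ℝ} (hf : LocallyIntegrableOn f (Ici 0)) (T : ℝ) :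
    ∃ F, Integrable F ∧ ExtendsBelow T F f := by
  refine ⟨(Ioo 0 T).indicator f, ?_, ?_⟩
  · rw [integrable_indicator_iff measurableSet_Ioo]
    exact locallyIntegrableOn_Ici_zero_iff.1 hf T
  · intro s hs
    by_cases h : 0 < s
    · rw [indicator_of_mem (show s ∈ Ioo 0 T from ⟨h, hs.resolve_left (not_le.2 h)⟩),
        indicator_of_mem (show s ∈ Ioi 0 from h)]
    · rw [indicator_of_notMem (fun h' => h h'.1), indicator_of_notMem (show s ∉ Ioi 0 from h)]

theorem ExtendsBelow.eq {T : ℝ} {F f : ℝ → ℝ} (h : ExtendsBelow T F f) {s : ℝ}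
    (hs : s ∈ Ioo 0 T) : F s = f s := by
  rw [h s (Or.inr hs.2), indicator_of_mem (show s ∈ Ioi 0 from hs.1)]

theorem ae_Ioi_of_forall_Ioo {p : ℝ → Prop}
    (h : ∀ T : ℝ, ∀ᵐ t, t ∈ Ioo 0 T → p t) : ∀ᵐ t ∂vol₊, p t := by
  rw [ae_restrict_iff' measurableSet_Ioi]
  have := ae_all_iff.2 fun n : ℕ => h n
  filter_upwards [this] with t ht h0
  obtain ⟨n, hn⟩ := exists_nat_gt t
  exact ht n ⟨h0, hn⟩

theorem integrable_lineConv {F G : ℝ → ℝ} (hF : Integrable F) (hG : Integrable G) :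
    Integrable (lineConv F G) :=
  hF.integrable_convolution _ hG

theorem locallyIntegrableOn_halfConv {f g : ℝ → ℝ} (hf : LocallyIntegrableOn f (Ici 0))
    (hg : LocallyIntegrableOn g (Ici 0)) : LocallyIntegrableOn (halfConv f g) (Ici 0) := by
  rw [locallyIntegrableOn_Ici_zero_iff]
  intro T
  obtain ⟨F, hF, hFe⟩ := exists_extendsBelow hf T
  obtain ⟨G, hG, hGe⟩ := exists_extendsBelow hg T
  refine ((integrable_lineConv hF hG).integrableOn (s := Ioo 0 T)).congr_fun ?_ measurableSet_Ioo
  intro s hs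
  exact (hFe.lineConv hGe).eq hs

theorem lineConv_assoc_ae {F G H : ℝ → ℝ} (hF : Integrable F) (hG : Integrable G)
    (hH : Integrable H) :
    ∀ᵐ t, lineConv (lineConv F G) H t = lineConv F (lineConv G H) t := by
  have h3 := hF.norm.ae_convolution_exists (ContinuousLinearMap.mul ℝ ℝ)
    (hG.norm.integrable_convolution (ContinuousLinearMap.mul ℝ ℝ) hH.norm)
  filter_upwards [h3] with t ht
  exact convolution_assoc _ _ _ _ (fun x y z => by simp [mul_assoc]) hF.aestronglyMeasurable
    hG.aestronglyMeasurable hH.aestronglyMeasurable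
    (hF.ae_convolution_exists _ hG) (hG.norm.ae_convolution_exists _ hH.norm) ht

theorem halfConv_assoc {f g h : ℝ → ℝ} (hf : LocallyIntegrableOn f (Ici 0))
    (hg : LocallyIntegrableOn g (Ici 0)) (hh : LocallyIntegrableOn h (Ici 0)) :
    ∀ᵐ t ∂vol₊, halfConv (halfConv f g) h t = halfConv f (halfConv g h) t := by
  apply ae_Ioi_of_forall_Ioo
  intro T
  obtain ⟨F, hF, hFe⟩ := exists_extendsBelow hf T
  obtain ⟨G, hG, hGe⟩ := exists_extendsBelow hg T
  obtain ⟨H, hH, hHe⟩ := exists_extendsBelow hh T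
  filter_upwards [lineConv_assoc_ae hF hG hH] with t ht htT
  rw [← ((hFe.lineConv hGe).lineConv hHe).eq htT, ht, (hFe.lineConv (hGe.lineConv hHe)).eq htT]

theorem halfConv_congr_right {f g g' : ℝ → ℝ} (h : g =ᵐ[vol₊] g') {t : ℝ} (ht : 0 ≤ t) :
    halfConv f g t = halfConv f g' t := by
  rw [halfConv_eq_setIntegral _ _ ht, halfConv_eq_setIntegral _ _ ht]
  apply integral_congr_ae
  have : g =ᵐ[volume.restrict (Ioo 0 t)] g' :=
    ae_mono (Measure.restrict_mono Ioo_subset_Ioi_self le_rfl) h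
  filter_upwards [this] with s hs
  rw [hs]

theorem halfConv_congr_left {f f' g : ℝ → ℝ} (h : f =ᵐ[vol₊] f') {t : ℝ} (ht : 0 ≤ t) :
    halfConv f g t = halfConv f' g t := by
  rw [halfConv_comm, halfConv_congr_right h ht, halfConv_comm]

theorem halfConv_const_mul_right (f g : ℝ → ℝ) (c t : ℝ) :
    halfConv f (fun s => c * g s) t = c * halfConv f g t := by
  unfold halfConv
  rw [← intervalIntegral.integral_const_mul]
  exact intervalIntegral.integral_congr fun s _ => by ring

theorem halfConv_const_mul_left (f g : ℝ → ℝ) (c t : ℝ) :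
    halfConv (fun s => c * f s) g t = c * halfConv f g t := by
  rw [halfConv_comm, halfConv_const_mul_right, halfConv_comm]

theorem halfConv_integrand_integrable {f g : ℝ → ℝ} (hf : LocallyIntegrableOn f (Ici 0))
    (hg : LocallyIntegrableOn g (Ici 0)) :
    ∀ᵐ t ∂vol₊, IntegrableOn (fun s => f (t - s) * g s) (Ioo 0 t) := by
  apply ae_Ioi_of_forall_Ioo
  intro T
  obtain ⟨F, hF, hFe⟩ := exists_extendsBelow hf T
  obtain ⟨G, hG, hGe⟩ := exists_extendsBelow hg T
  filter_upwards [hF.ae_convolution_exists (ContinuousLinearMap.mul ℝ ℝ) hG] with t ht htT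
  have := ((convolutionExistsAt_iff_integrable_swap (L := ContinuousLinearMap.mul ℝ ℝ)).1 ht)
  refine (this.integrableOn (s := Ioo 0 t)).congr_fun ?_ measurableSet_Ioo
  intro s hs
  simp only [ContinuousLinearMap.mul_apply']
  rw [hFe.eq ⟨by linarith [hs.2], by linarith [hs.1, htT.2]⟩, hGe.eq ⟨hs.1, hs.2.trans htT.2⟩]

theorem halfConv_add_right {f g h : ℝ → ℝ} (hf : LocallyIntegrableOn f (Ici 0))
    (hg : LocallyIntegrableOn g (Ici 0)) (hh : LocallyIntegrableOn h (Ici 0)) :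
    ∀ᵐ t ∂vol₊, halfConv f (fun s => g s + h s) t = halfConv f g t + halfConv f h t := by
  filter_upwards [halfConv_integrand_integrable hf hg, halfConv_integrand_integrable hf hh,
    ae_restrict_mem measurableSet_Ioi] with t h1 h2 h0
  simp_rw [halfConv_eq_setIntegral _ _ (le_of_lt h0)]
  rw [← integral_add h1 h2]
  exact integral_congr_ae (ae_of_all _ fun s => by ring)

theorem halfConv_add_left {f g h : ℝ → ℝ} (hf : LocallyIntegrableOn f (Ici 0))
    (hg : LocallyIntegrableOn g (Ici 0)) (hh : LocallyIntegrableOn h (Ici 0)) :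
    ∀ᵐ t ∂vol₊, halfConv (fun s => g s + h s) f t = halfConv g f t + halfConv h f t := by
  filter_upwards [halfConv_add_right hf hg hh] with t ht
  rw [halfConv_comm, ht, halfConv_comm f g, halfConv_comm f h]

theorem one_halfConv (f : ℝ → ℝ) (t : ℝ) :
    halfConv (fun _ => 1) f t = ∫ s in (0 : ℝ)..t, f s := by
  simp [halfConv]

theorem intervalIntegrable_of_locallyIntegrableOn {f : ℝ → ℝ}
    (hf : LocallyIntegrableOn f (Ici 0)) {a b : ℝ} (ha : 0 ≤ a) (hb : 0 ≤ b) :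
    IntervalIntegrable f volume a b := by
  rw [intervalIntegrable_iff]
  refine ((locallyIntegrableOn_iff isClosed_Ici.isLocallyClosed).1 hf (Icc (min a b) (max a b))
    ?_ isCompact_Icc).mono_set ?_
  · intro x hx
    exact (le_min ha hb).trans hx.1
  · exact uIoc_subset_uIcc

theorem continuousOn_primitive_halfLine {f : ℝ → ℝ} (hf : LocallyIntegrableOn f (Ici 0)) :
    ContinuousOn (fun t => ∫ s in (0 : ℝ)..t, f s) (Ici 0) := by
  intro t ht
  have h := intervalIntegral.continuousOn_primitive_interval (f := f) (a := 0) (b := t + 1)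
    (μ := volume) (by
      rw [uIcc_of_le (by linarith [mem_Ici.1 ht])]
      exact (locallyIntegrableOn_iff isClosed_Ici.isLocallyClosed).1 hf _
        (Icc_subset_Ici_self) isCompact_Icc)
  rw [uIcc_of_le (by linarith [mem_Ici.1 ht])] at h
  refine (h t ⟨ht, by linarith⟩).mono_of_mem_nhdsWithin ?_
  have : Iio (t + 1) ∈ 𝓝[Ici 0] t := mem_nhdsWithin_of_mem_nhds (Iio_mem_nhds (by linarith))
  filter_upwards [this, self_mem_nhdsWithin] with x hx h0
  exact ⟨h0, le_of_lt hx⟩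

theorem ae_hasDerivAt_primitive {f : ℝ → ℝ} (hf : LocallyIntegrableOn f (Ici 0)) :
    ∀ᵐ t ∂vol₊, HasDerivAt (fun t => ∫ s in (0 : ℝ)..t, f s) (f t) t := by
  apply ae_Ioi_of_forall_Ioo
  intro T
  by_cases hT : 0 ≤ T
  · have := (intervalIntegrable_of_locallyIntegrableOn hf le_rfl hT).ae_hasDerivAt_integral
    filter_upwards [this] with t ht h
    have h' : t ∈ uIcc 0 T := by
      rw [uIcc_of_le hT]; exact ⟨h.1.le, h.2.le⟩
    exact ht h' 0 left_mem_uIcc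
  · exact ae_of_all _ fun t ht => absurd (ht.1.trans ht.2).le hT

theorem continuousOn_eq_of_ae_eq {f g : ℝ → ℝ} (hf : ContinuousOn f (Ioi 0))
    (hg : ContinuousOn g (Ioi 0)) (h : f =ᵐ[vol₊] g) : EqOn f g (Ioi 0) :=
  Measure.eqOn_open_of_ae_eq h isOpen_Ioi hf hg

theorem ae_eq_of_one_halfConv_eq {f g : ℝ → ℝ} (hf : LocallyIntegrableOn f (Ici 0))
    (hg : LocallyIntegrableOn g (Ici 0))
    (h : ∀ᵐ t ∂vol₊, halfConv (fun _ => 1) f t = halfConv (fun _ => 1) g t) : f =ᵐ[vol₊] g := by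
  simp_rw [one_halfConv] at h
  have heq := continuousOn_eq_of_ae_eq
    ((continuousOn_primitive_halfLine hf).mono Ioi_subset_Ici_self)
    ((continuousOn_primitive_halfLine hg).mono Ioi_subset_Ici_self) h
  filter_upwards [ae_hasDerivAt_primitive hf, ae_hasDerivAt_primitive hg,
    ae_restrict_mem measurableSet_Ioi] with t h1 h2 h0
  exact h1.unique (h2.congr_of_eventuallyEq
    (heq.eventuallyEq_of_mem (Ioi_mem_nhds h0)))

theorem locallyIntegrableOn_const_halfLine (c : ℝ) :
    LocallyIntegrableOn (fun _ : ℝ => c) (Ici 0) :=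
  (locallyIntegrable_const c).locallyIntegrableOn _

/-- If `κ ∗ l = 1` and `κ ∗ a = 1 ∗ b`, then `a = l ∗ b`. -/
theorem ae_eq_halfConv_of_conv_eq_one {κ l a b : ℝ → ℝ} (hκ : LocallyIntegrableOn κ (Ici 0))
    (hl : LocallyIntegrableOn l (Ici 0)) (ha : LocallyIntegrableOn a (Ici 0))
    (hb : LocallyIntegrableOn b (Ici 0)) (h1 : ∀ᵐ t ∂vol₊, halfConv κ l t = 1)
    (h : ∀ᵐ t ∂vol₊, halfConv κ a t = halfConv (fun _ => 1) b t) :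
    a =ᵐ[vol₊] halfConv l b := by
  have one := locallyIntegrableOn_const_halfLine 1
  apply ae_eq_of_one_halfConv_eq ha (locallyIntegrableOn_halfConv hl hb)
  filter_upwards [halfConv_assoc hl hκ ha, halfConv_assoc hl one hb, halfConv_assoc one hl hb,
    ae_restrict_mem measurableSet_Ioi] with t e1 e2 e3 h0
  have h0' : (0 : ℝ) ≤ t := le_of_lt h0
  have h1' : halfConv l κ =ᵐ[vol₊] fun _ => 1 := by
    filter_upwards [h1] with t ht
    rw [halfConv_comm, ht]
  rw [← halfConv_congr_left h1' h0', e1, halfConv_congr_right h h0', ← e2, ← e3]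
  congr 1
  ext s
  exact halfConv_comm _ _ _

theorem halfConv_continuousAt {f g : ℝ → ℝ} (hf : LocallyIntegrableOn f (Ici 0))
    (hg : ContinuousOn g (Ioi 0)) {C t₀ : ℝ} (ht₀ : 0 < t₀)
    (hC : ∀ t, 0 < t → t < t₀ + 1 → |g t| ≤ C) :
    ContinuousAt (halfConv f g) t₀ := by
  have hC0 : 0 ≤ C := (abs_nonneg _).trans (hC t₀ ht₀ (by linarith))
  obtain ⟨F, hF, hFe⟩ := exists_extendsBelow hf (t₀ + 1)
  have heq : ∀ᶠ t in 𝓝 t₀, (∫ s, F s * (Ioi (0 : ℝ)).indicator g (t - s)) = halfConv f g t := by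
    filter_upwards [Ioi_mem_nhds ht₀, Iio_mem_nhds (show t₀ < t₀ + 1 by linarith)] with t h0 h1
    have hG : ExtendsBelow (t₀ + 1) ((Ioi (0 : ℝ)).indicator g) g := fun s _ => rfl
    exact (hFe.lineConv hG).eq ⟨h0, h1⟩
  refine ContinuousAt.congr ?_ heq
  have hgm : AEStronglyMeasurable ((Ioi (0 : ℝ)).indicator g) volume :=
    (aestronglyMeasurable_indicator_iff measurableSet_Ioi).2
      (hg.aestronglyMeasurable measurableSet_Ioi)
  apply continuousAt_of_dominated (bound := fun s => C * |F s|)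
  · refine Eventually.of_forall fun t => hF.aestronglyMeasurable.mul ?_
    exact hgm.comp_quasiMeasurePreserving
      (quasiMeasurePreserving_sub_left_of_right_invariant volume t)
  · filter_upwards [Iio_mem_nhds (show t₀ < t₀ + 1 by linarith)] with t htT
    refine ae_of_all _ fun s => ?_
    rw [norm_mul, Real.norm_eq_abs, mul_comm]
    by_cases h0 : 0 < s
    · gcongr
      by_cases h : 0 < t - s
      · rw [indicator_of_mem (show t - s ∈ Ioi 0 from h)]
        exact hC _ h (by linarith [mem_Iio.1 htT])
      · rw [indicator_of_notMem (show t - s ∉ Ioi 0 from h)]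
        simpa using hC0
    · rw [hFe s (Or.inl (not_lt.1 h0)), indicator_of_notMem (show s ∉ Ioi 0 from h0)]
      simp
  · exact hF.abs.const_mul C
  · have : ∀ᵐ s : ℝ, s ≠ t₀ := by simp [ae_iff]
    filter_upwards [this] with s hs
    apply ContinuousAt.mul continuousAt_const
    rcases lt_or_gt_of_ne hs with h | h
    · have : ContinuousAt g (t₀ - s) := hg.continuousAt (Ioi_mem_nhds (sub_pos.2 h))
      have h2 : ContinuousAt (fun t => g (t - s)) t₀ :=
        ContinuousAt.comp (f := fun t => t - s) this (by fun_prop)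
      refine h2.congr ?_
      filter_upwards [Ioi_mem_nhds h] with t ht
      rw [indicator_of_mem (show t - s ∈ Ioi 0 from sub_pos.2 (mem_Ioi.1 ht))]
    · refine (continuousAt_const (y := (0 : ℝ))).congr ?_
      filter_upwards [Iio_mem_nhds h] with t ht
      rw [indicator_of_notMem]
      simpa using le_of_lt ht

theorem integrableOn_exp_mul_of_le {f : ℝ → ℝ} {a b : ℝ} (hab : a ≤ b)
    (hf : IntegrableOn (fun t => Real.exp (-a * t) * f t) (Ioi 0)) :
    IntegrableOn (fun t => Real.exp (-b * t) * f t) (Ioi 0) := by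
  have h : (fun t => Real.exp (-b * t) * f t)
      = fun t => Real.exp (-(b - a) * t) * (Real.exp (-a * t) * f t) := by
    ext t
    rw [← mul_assoc, ← Real.exp_add]
    ring_nf
  rw [h]
  refine Integrable.bdd_mul (c := 1) hf (by fun_prop) ?_
  filter_upwards [ae_restrict_mem measurableSet_Ioi] with t ht
  rw [Real.norm_eq_abs, Real.abs_exp]
  exact Real.exp_le_one_iff.2 (by nlinarith [mem_Ioi.1 ht])

theorem halfLaplace_tendsto_zero {f : ℝ → ℝ} {a : ℝ}
    (hf : IntegrableOn (fun t => Real.exp (-a * t) * f t) (Ioi 0)) :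
    Tendsto (halfLaplace f) atTop (𝓝 0) := by
  have h0 : (0 : ℝ) = ∫ t in Ioi (0 : ℝ), (0 : ℝ) := by simp
  rw [h0]
  unfold halfLaplace
  apply tendsto_integral_filter_of_dominated_convergence
    (fun t => ‖Real.exp (-a * t) * f t‖)
  · filter_upwards [eventually_ge_atTop a] with b hb
    exact (integrableOn_exp_mul_of_le hb hf).aestronglyMeasurable
  · filter_upwards [eventually_ge_atTop a] with b hb
    filter_upwards [ae_restrict_mem measurableSet_Ioi] with t ht
    rw [norm_mul, norm_mul]
    gcongr
    rw [Real.norm_eq_abs, Real.norm_eq_abs, Real.abs_exp, Real.abs_exp]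
    exact Real.exp_le_exp.2 (by nlinarith [mem_Ioi.1 ht])
  · exact hf.norm
  · filter_upwards [ae_restrict_mem measurableSet_Ioi] with t ht
    have h1 : Tendsto (fun b : ℝ => Real.exp (-b * t)) atTop (𝓝 0) := by
      refine Real.tendsto_exp_atBot.comp ?_
      simp_rw [neg_mul]
      exact tendsto_neg_atTop_atBot.comp (tendsto_id.atTop_mul_const ht)
    simpa using h1.mul_const (f t)

theorem integrableOn_exp_mul_of_antitone {f : ℝ → ℝ} (hf : LocallyIntegrableOn f (Ici 0))
    (h0 : ∀ t, 0 < t → 0 ≤ f t) (ha : AntitoneOn f (Ioi 0)) {l : ℝ} (hl : 0 < l) :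
    IntegrableOn (fun t => Real.exp (-l * t) * f t) (Ioi 0) := by
  rw [← Ioc_union_Ioi_eq_Ioi (zero_le_one (α := ℝ))]
  have hm : AEStronglyMeasurable f vol₊ :=
    (hf.mono_set Ioi_subset_Ici_self).aestronglyMeasurable
  refine IntegrableOn.union ?_ ?_
  · have h1 : IntegrableOn f (Ioc 0 1) := by
      rw [integrableOn_Ioc_iff_integrableOn_Ioo]
      exact locallyIntegrableOn_Ici_zero_iff.1 hf 1
    refine Integrable.bdd_mul (c := 1) h1 (by fun_prop) ?_
    filter_upwards [ae_restrict_mem measurableSet_Ioc] with t ht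
    rw [Real.norm_eq_abs, Real.abs_exp]
    exact Real.exp_le_one_iff.2 (by nlinarith [ht.1])
  · have h1 : IntegrableOn (fun t => Real.exp (-l * t)) (Ioi 1) := exp_neg_integrableOn_Ioi 1 hl
    refine Integrable.mul_bdd (c := f 1) h1
      (hm.mono_measure (Measure.restrict_mono (Ioi_subset_Ioi zero_le_one) le_rfl)) ?_
    filter_upwards [ae_restrict_mem measurableSet_Ioi] with t ht
    have ht' : (1 : ℝ) < t := ht
    have ht0 : (0 : ℝ) < t := by linarith
    rw [Real.norm_eq_abs, abs_of_nonneg (h0 t ht0)]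
    exact ha (mem_Ioi.2 one_pos) ht0 ht'.le

theorem continuous_integral_Iio_mul_comp_sub {κ : ℝ → ℝ} (hκ : Integrable κ) {h : ℝ → ℝ}
    (hh : Continuous h) {C : ℝ} (hC : ∀ t, ‖h t‖ ≤ C) :
    Continuous fun t => ∫ s in Iio t, κ s * h (t - s) := by
  simp_rw [← integral_indicator measurableSet_Iio]
  rw [continuous_iff_continuousAt]
  intro t₀
  apply continuousAt_of_dominated (bound := fun s => ‖κ s‖ * C)
  · refine Eventually.of_forall fun t => ?_
    exact (hκ.aestronglyMeasurable.mul
      (hh.comp (by fun_prop : Continuous fun s => t - s)).aestronglyMeasurable).indicator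
      measurableSet_Iio
  · refine Eventually.of_forall fun t => ae_of_all _ fun s => ?_
    refine (norm_indicator_le_norm_self _ _).trans ?_
    rw [norm_mul]
    gcongr
    exact hC _
  · exact hκ.norm.mul_const C
  · have : ∀ᵐ s : ℝ, s ≠ t₀ := by simp [ae_iff]
    filter_upwards [this] with s hs
    rcases lt_or_gt_of_ne hs with h' | h'
    · have h2 : ContinuousAt (fun t => κ s * h (t - s)) t₀ := by fun_prop
      refine h2.congr ?_
      filter_upwards [Ioi_mem_nhds h'] with t ht
      rw [indicator_of_mem (show s ∈ Iio t from ht)]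
    · refine (continuousAt_const (y := (0 : ℝ))).congr ?_
      filter_upwards [Iio_mem_nhds h'] with t ht
      rw [indicator_of_notMem]
      simpa using le_of_lt ht

open scoped BoundedContinuousFunction in
theorem exists_volterra_solution_of_small {κ : ℝ → ℝ} (hκ : Integrable κ)
    (hsmall : ∫ s, ‖κ s‖ ≤ 1 / 2) (c : ℝ →ᵇ ℝ) :
    ∃ h : ℝ →ᵇ ℝ, ∀ t, h t = c t - ∫ s in Iio t, κ s * h (t - s) := by
  have bound : ∀ (h : ℝ →ᵇ ℝ) t, ‖∫ s in Iio t, κ s * h (t - s)‖ ≤ 1 / 2 * ‖h‖ := by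
    intro h t
    calc ‖∫ s in Iio t, κ s * h (t - s)‖ ≤ ∫ s in Iio t, ‖κ s‖ * ‖h‖ := by
          apply norm_integral_le_of_norm_le (hκ.norm.mul_const _).integrableOn
          refine ae_of_all _ fun s => ?_
          rw [norm_mul]
          gcongr
          exact h.norm_coe_le_norm _
      _ ≤ ∫ s, ‖κ s‖ * ‖h‖ := by
          apply setIntegral_le_integral (hκ.norm.mul_const _)
          exact ae_of_all _ fun s => by positivity
      _ ≤ 1 / 2 * ‖h‖ := by
          rw [integral_mul_const]
          gcongr
  let Φ : (ℝ →ᵇ ℝ) → (ℝ →ᵇ ℝ) := fun h => c - BoundedContinuousFunction.ofNormedAddCommGroup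
    (fun t => ∫ s in Iio t, κ s * h (t - s))
    (continuous_integral_Iio_mul_comp_sub hκ h.continuous h.norm_coe_le_norm)
    (1 / 2 * ‖h‖) (bound h)
  have hΦ : ∀ h t, Φ h t = c t - ∫ s in Iio t, κ s * h (t - s) := fun h t => rfl
  have hint : ∀ (h : ℝ →ᵇ ℝ) t, IntegrableOn (fun s => κ s * h (t - s)) (Iio t) := fun h t =>
    Integrable.mul_bdd (c := ‖h‖) hκ.integrableOn
      (h.continuous.comp (by fun_prop : Continuous fun s => t - s)).aestronglyMeasurable
      (ae_of_all _ fun s => h.norm_coe_le_norm _)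
  have hcontr : ContractingWith (1 / 2) Φ := by
    refine ⟨by rw [← NNReal.coe_lt_coe]; norm_num, LipschitzWith.of_dist_le_mul fun h₁ h₂ => ?_⟩
    rw [BoundedContinuousFunction.dist_le (by positivity)]
    intro t
    rw [hΦ, hΦ, dist_eq_norm, dist_eq_norm h₁ h₂, sub_sub_sub_cancel_left,
      ← integral_sub (hint _ _) (hint _ _)]
    have := bound (h₂ - h₁) t
    rw [norm_sub_rev h₁ h₂]
    refine le_trans (le_of_eq ?_) (this.trans (le_of_eq (by simp)))
    congr 1
    refine integral_congr_ae (ae_of_all _ fun s => ?_)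
    simp only [BoundedContinuousFunction.coe_sub, Pi.sub_apply]
    ring
  refine ⟨hcontr.fixedPoint Φ, fun t => ?_⟩
  rw [← hΦ, hcontr.fixedPoint_isFixedPt.eq]

theorem exists_volterra_solution {K : ℝ → ℝ} (hK : LocallyIntegrableOn K (Ici 0))
    (h0 : ∀ t, 0 < t → 0 ≤ K t) (ha : AntitoneOn K (Ioi 0)) :
    ∃ g : ℝ → ℝ, Continuous g ∧ ∀ t, 0 ≤ t → g t + halfConv K g t = 1 := by
  have hint := fun {l : ℝ} (hl : 0 < l) => integrableOn_exp_mul_of_antitone hK h0 ha hl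
  have hlim := halfLaplace_tendsto_zero (hint one_pos)
  obtain ⟨w, hw2, hw⟩ := ((hlim.eventually_le_const (by norm_num : (0 : ℝ) < 1 / 2)).and
    (eventually_gt_atTop 0)).exists
  set κ : ℝ → ℝ := (Ioi (0 : ℝ)).indicator fun s => Real.exp (-w * s) * K s with hκdef
  have hκ : Integrable κ := (integrable_indicator_iff measurableSet_Ioi).2 (hint hw)
  have hsmall : ∫ s, ‖κ s‖ ≤ 1 / 2 := by
    refine le_trans (le_of_eq ?_) hw2
    rw [halfLaplace, ← integral_indicator measurableSet_Ioi]
    refine integral_congr_ae (ae_of_all _ fun s => ?_)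
    refine Real.norm_of_nonneg (indicator_nonneg (fun t ht => ?_) s)
    exact mul_nonneg (Real.exp_pos _).le (h0 t ht)
  obtain ⟨h, hh⟩ := exists_volterra_solution_of_small hκ hsmall
    (BoundedContinuousFunction.ofNormedAddCommGroup (fun t => Real.exp (-w * max t 0))
      (by fun_prop) 1 (fun t => by
        rw [Real.norm_eq_abs, Real.abs_exp]
        exact Real.exp_le_one_iff.2 (by nlinarith [le_max_right t 0])))
  refine ⟨fun t => Real.exp (w * t) * h t, by fun_prop, fun t ht => ?_⟩
  have h1 := hh t
  simp only [BoundedContinuousFunction.coe_ofNormedAddCommGroup, max_eq_left ht] at h1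
  have h2 : ∫ s in Iio t, κ s * h (t - s)
      = Real.exp (-w * t) * halfConv K (fun t => Real.exp (w * t) * h t) t := by
    rw [halfConv_comm, halfConv_eq_setIntegral _ _ ht, ← integral_const_mul,
      ← integral_indicator measurableSet_Iio, ← integral_indicator measurableSet_Ioo]
    refine integral_congr_ae (ae_of_all _ fun s => ?_)
    by_cases hs : s < t
    · by_cases hs0 : 0 < s
      · simp only [hκdef]
        rw [indicator_of_mem (show s ∈ Iio t from hs), indicator_of_mem (show s ∈ Ioi 0 from hs0),
          indicator_of_mem (show s ∈ Ioo 0 t from ⟨hs0, hs⟩)]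
        have : Real.exp (-w * s) = Real.exp (-w * t) * Real.exp (w * (t - s)) := by
          rw [← Real.exp_add]; ring_nf
        rw [this]; ring
      · simp only [hκdef]
        rw [indicator_of_mem (show s ∈ Iio t from hs),
          indicator_of_notMem (show s ∉ Ioi 0 from hs0),
          indicator_of_notMem (fun h => hs0 h.1), zero_mul]
    · rw [indicator_of_notMem (show s ∉ Iio t from hs), indicator_of_notMem (fun h => hs h.2)]
  rw [h2] at h1
  have h3 : Real.exp (w * t) * Real.exp (-w * t) = 1 := by
    rw [← Real.exp_add]; simp
  linear_combination Real.exp (w * t) * h1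
    + (1 - halfConv K (fun t => Real.exp (w * t) * h t) t) * h3

theorem intervalIntegrable_conv_integrand {K g : ℝ → ℝ} (hK : LocallyIntegrableOn K (Ici 0))
    (hg : Continuous g) {a b t : ℝ} (hat : a ≤ t) (hbt : b ≤ t) :
    IntervalIntegrable (fun s => K (t - s) * g s) volume a b := by
  refine IntervalIntegrable.mul_continuousOn ?_ hg.continuousOn
  have := (intervalIntegrable_of_locallyIntegrableOn hK (sub_nonneg.2 hat)
    (sub_nonneg.2 hbt)).comp_sub_left t
  simpa using this

theorem volterra_solution_nonneg {K g : ℝ → ℝ} (hK : LocallyIntegrableOn K (Ici 0))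
    (h0 : ∀ t, 0 < t → 0 ≤ K t) (ha : AntitoneOn K (Ioi 0)) (hg : Continuous g)
    (heq : ∀ t, 0 ≤ t → g t + halfConv K g t = 1) {t : ℝ} (ht : 0 ≤ t) : 0 ≤ g t := by
  by_contra! hneg
  have hg0 : g 0 = 1 := by simpa [halfConv] using heq 0 le_rfl
  let S : Set ℝ := Ici 0 ∩ g ⁻¹' Iic 0
  have hSc : IsClosed S := isClosed_Ici.inter (isClosed_Iic.preimage hg)
  have hSb : BddBelow S := ⟨0, fun x hx => hx.1⟩
  have hS := hSc.csInf_mem ⟨t, ht, hneg.le⟩ hSb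
  set t₀ := sInf S with ht₀def
  have hgt₀ : g t₀ ≤ 0 := hS.2
  have ht₀ : 0 < t₀ := by
    refine lt_of_le_of_ne hS.1 fun h => ?_
    rw [← h, hg0] at hgt₀
    linarith
  have hpos : ∀ s, 0 ≤ s → s < t₀ → 0 < g s := by
    intro s hs hst
    by_contra! h
    exact absurd (csInf_le hSb (show s ∈ S from ⟨hs, h⟩)) (not_le.2 hst)
  have key : ∀ t, 0 ≤ t → t < t₀ → g t ≤ ∫ s in t..t₀, K (t₀ - s) * g s := by
    intro t ht htt
    have e1 := heq t ht
    have e2 := heq t₀ ht₀.le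
    have hsplit := intervalIntegral.integral_add_adjacent_intervals
      (intervalIntegrable_conv_integrand hK hg ht₀.le htt.le)
      (intervalIntegrable_conv_integrand hK hg htt.le le_rfl)
    have hmono : (∫ s in (0 : ℝ)..t, K (t₀ - s) * g s) ≤ ∫ s in (0 : ℝ)..t, K (t - s) * g s := by
      apply intervalIntegral.integral_mono_on_of_le_Ioo ht
        (intervalIntegrable_conv_integrand hK hg ht₀.le htt.le)
        (intervalIntegrable_conv_integrand hK hg ht le_rfl)
      intro s hs
      apply mul_le_mul_of_nonneg_right _ (hpos s hs.1.le (hs.2.trans htt)).le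
      exact ha (mem_Ioi.2 (by linarith [hs.2])) (mem_Ioi.2 (by linarith [hs.2])) (by linarith)
    unfold halfConv at e1 e2
    linarith
  have hcont := continuousOn_primitive_halfLine hK
  have hsm : ∀ᶠ δ in 𝓝[>] (0 : ℝ), (∫ s in (0 : ℝ)..δ, K s) < 1 / 2 := by
    have h1 : Tendsto (fun t => ∫ s in (0 : ℝ)..t, K s) (𝓝[>] 0) (𝓝 0) := by
      have := (hcont 0 self_mem_Ici).tendsto.mono_left (nhdsWithin_mono 0 Ioi_subset_Ici_self)
      simpa using this
    exact h1.eventually_lt_const (by norm_num)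
  obtain ⟨δ, hδ, hδ0, hδt⟩ := (hsm.and (Ioo_mem_nhdsGT ht₀)).exists
  obtain ⟨x, hx, hxmax⟩ := isCompact_Icc.exists_isMaxOn (nonempty_Icc.2 (by linarith : t₀ - δ ≤ t₀))
    hg.continuousOn
  have hgx : 0 < g x := (hpos (t₀ - δ) (by linarith) (by linarith)).trans_le
    (hxmax ⟨le_rfl, by linarith⟩)
  have hxt : x < t₀ := lt_of_le_of_ne hx.2 fun h => by rw [h] at hgx; linarith
  have h1 := key x (by linarith [hx.1]) hxt
  have h2 : (∫ s in x..t₀, K (t₀ - s) * g s) ≤ ∫ s in x..t₀, K (t₀ - s) * g x := by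
    apply intervalIntegral.integral_mono_on_of_le_Ioo hxt.le
      (intervalIntegrable_conv_integrand hK hg hxt.le le_rfl)
      (intervalIntegrable_conv_integrand (g := fun _ => g x) hK continuous_const hxt.le le_rfl)
    intro s hs
    exact mul_le_mul_of_nonneg_left (hxmax ⟨by linarith [hx.1, hs.1], hs.2.le⟩)
      (h0 _ (by linarith [hs.2]))
  rw [intervalIntegral.integral_mul_const, intervalIntegral.integral_comp_sub_left (fun s => K s),
    sub_self] at h2
  have h3 : (∫ s in (0 : ℝ)..(t₀ - x), K s) ≤ ∫ s in (0 : ℝ)..δ, K s := by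
    apply intervalIntegral.integral_mono_interval le_rfl (by linarith) (by linarith [hx.1])
    · filter_upwards [ae_restrict_mem measurableSet_Ioc] with s hs
      exact h0 s hs.1
    · exact intervalIntegrable_of_locallyIntegrableOn hK le_rfl hδ0.le
  nlinarith

theorem volterra_solution_le_one {K g : ℝ → ℝ} (h0 : ∀ t, 0 < t → 0 ≤ K t)
    (hg : ∀ t, 0 ≤ t → 0 ≤ g t) (heq : ∀ t, 0 ≤ t → g t + halfConv K g t = 1) {t : ℝ}
    (ht : 0 ≤ t) : g t ≤ 1 := by
  have : 0 ≤ halfConv K g t := by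
    rw [halfConv_eq_setIntegral _ _ ht]
    refine setIntegral_nonneg measurableSet_Ioo fun s hs => ?_
    exact mul_nonneg (h0 _ (by linarith [hs.2])) (hg s hs.1.le)
  linarith [heq t ht]

theorem halfConv_nonneg {f g : ℝ → ℝ} (hf : ∀ᵐ t ∂vol₊, 0 ≤ f t) (hg : ∀ᵐ t ∂vol₊, 0 ≤ g t)
    {t : ℝ} (ht : 0 ≤ t) : 0 ≤ halfConv f g t := by
  have hf' : f =ᵐ[vol₊] fun t => max (f t) 0 := hf.mono fun t h => (max_eq_left h).symm
  have hg' : g =ᵐ[vol₊] fun t => max (g t) 0 := hg.mono fun t h => (max_eq_left h).symm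
  rw [halfConv_congr_left hf' ht, halfConv_congr_right hg' ht, halfConv_eq_setIntegral _ _ ht]
  exact setIntegral_nonneg measurableSet_Ioo fun s _ =>
    mul_nonneg (le_max_right _ _) (le_max_right _ _)

theorem le_of_ae_le_of_continuousOn {f g : ℝ → ℝ} (hf : ContinuousOn f (Ioi 0))
    (hg : ContinuousOn g (Ioi 0)) (h : f ≤ᵐ[vol₊] g) {t : ℝ} (ht : 0 < t) : f t ≤ g t := by
  have := continuousOn_eq_of_ae_eq (hf.sup hg) hg (h.mono fun t h => sup_eq_right.2 h)
  exact sup_eq_right.1 (this ht)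

theorem abs_halfConv_le {f g : ℝ → ℝ} (hf : LocallyIntegrableOn f (Ici 0)) {C t : ℝ} (ht : 0 ≤ t)
    (hg : ∀ s, 0 < s → s < t → |g s| ≤ C) :
    |halfConv f g t| ≤ (∫ s in (0 : ℝ)..t, |f s|) * C := by
  rw [halfConv_comm, halfConv_eq_setIntegral _ _ ht, intervalIntegral.integral_of_le ht,
    integral_Ioc_eq_integral_Ioo, ← integral_mul_const]
  rw [← Real.norm_eq_abs]
  refine norm_integral_le_of_norm_le (μ := volume.restrict (Ioo 0 t))
    ((locallyIntegrableOn_Ici_zero_iff.1 hf t).abs.mul_const C) ?_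
  filter_upwards [ae_restrict_mem measurableSet_Ioo] with s hs
  rw [norm_mul, mul_comm, Real.norm_eq_abs, Real.norm_eq_abs]
  gcongr
  exact hg _ (by linarith [hs.2]) (by linarith [hs.1])

theorem locallyIntegrableOn_abs {f : ℝ → ℝ} (hf : LocallyIntegrableOn f (Ici 0)) :
    LocallyIntegrableOn (fun t => |f t|) (Ici 0) := fun x hx => by
  obtain ⟨s, hs, h⟩ := hf x hx
  exact ⟨s, hs, h.abs⟩

/-- The primitive of `ℓ` is approximated, after one more integration, by convex functions. -/
theorem IsPC.exists_approx {k ℓ : ℝ → ℝ} (h : IsPC k ℓ) (n : ℕ) :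
    ∃ G : ℝ → ℝ, Continuous G ∧ Monotone G ∧ ∀ t, 0 < t →
      |(∫ s in (0 : ℝ)..t, ∫ u in (0 : ℝ)..s, ℓ u) - ∫ s in (0 : ℝ)..t, G s|
        ≤ 2 * (∫ s in (0 : ℝ)..t, |ℓ s|) ^ 2 / (n + 1) := by
  set c : ℝ := n + 1 with hc
  have hc0 : 0 < c := by positivity
  have hk := h.locallyIntegrable_left
  have hl := h.locallyIntegrable_right
  have hKl : LocallyIntegrableOn (fun t => c * k t) (Ici 0) := fun x hx => by
    obtain ⟨s, hs, h⟩ := hk x hx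
    exact ⟨s, hs, h.const_mul c⟩
  have hK0 : ∀ t, 0 < t → 0 ≤ c * k t := fun t ht => mul_nonneg hc0.le (h.nonneg t ht)
  have hKa : AntitoneOn (fun t => c * k t) (Ioi 0) := fun a ha b hb hab =>
    mul_le_mul_of_nonneg_left (h.antitone ha hb hab) hc0.le
  obtain ⟨g, hg, hgeq⟩ := exists_volterra_solution hKl hK0 hKa
  have hg0 := fun {t : ℝ} => volterra_solution_nonneg hKl hK0 hKa hg hgeq (t := t)
  have hg1 := fun {t : ℝ} => volterra_solution_le_one hK0 (fun _ => hg0) hgeq (t := t)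
  have hgli : LocallyIntegrableOn g (Ici 0) := hg.locallyIntegrable.locallyIntegrableOn _
  have one := locallyIntegrableOn_const_halfLine 1
  set A : ℝ → ℝ := fun t => ∫ s in (0 : ℝ)..t, |ℓ s| with hA
  have hAc : ContinuousOn A (Ioi 0) :=
    (continuousOn_primitive_halfLine (locallyIntegrableOn_abs hl)).mono Ioi_subset_Ici_self
  set L : ℝ → ℝ := fun t => ∫ u in (0 : ℝ)..t, ℓ u with hL
  have hLc : ContinuousOn L (Ici 0) := continuousOn_primitive_halfLine hl
  have hLli : LocallyIntegrableOn L (Ici 0) := hLc.locallyIntegrableOn measurableSet_Ici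
  set P : ℝ → ℝ := fun t => ∫ u in (0 : ℝ)..t, g u with hP
  have hPc : Continuous P := intervalIntegral.continuous_primitive
    (fun a b => hg.intervalIntegrable a b) 0
  have hPli : LocallyIntegrableOn P (Ici 0) := hPc.locallyIntegrable.locallyIntegrableOn _
  -- first identity, almost everywhere
  have id1 : ∀ᵐ t ∂vol₊, halfConv ℓ g t = L t + (-c) * P t := by
    have hkg := locallyIntegrableOn_halfConv hKl hgli
    have hlk : halfConv ℓ k =ᵐ[vol₊] fun _ => 1 := by
      filter_upwards [h.conv_eq_one] with t ht
      rw [halfConv_comm, ht]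
    filter_upwards [halfConv_add_right hl hgli hkg, halfConv_assoc hl hk hgli,
      ae_restrict_mem measurableSet_Ioi] with t e1 e2 h0
    have h0' : (0 : ℝ) ≤ t := le_of_lt h0
    have e3 : halfConv ℓ (fun s => g s + halfConv (fun t => c * k t) g s) t
        = halfConv ℓ (fun _ => 1) t := by
      apply halfConv_congr_right _ h0'
      filter_upwards [ae_restrict_mem measurableSet_Ioi] with s hs
      exact hgeq s (le_of_lt hs)
    have e4 : halfConv ℓ (halfConv (fun t => c * k t) g) t = c * P t := by
      have : halfConv (fun t => c * k t) g = fun s => c * halfConv k g s := by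
        ext s; exact halfConv_const_mul_left _ _ _ _
      rw [this, halfConv_const_mul_right, ← e2, halfConv_congr_left hlk h0', one_halfConv]
    rw [e3, halfConv_comm, one_halfConv, e4] at e1
    simp only [hL]
    linarith
  have hconv := locallyIntegrableOn_halfConv hl hgli
  have bound1 : ∀ᵐ t ∂vol₊, c * P t ≤ 2 * A t := by
    filter_upwards [id1, ae_restrict_mem measurableSet_Ioi] with t ht h0
    have h0' : (0 : ℝ) ≤ t := le_of_lt h0
    have e1 := abs_halfConv_le (g := g) (C := 1) hl h0' (fun s hs _ => by
      rw [abs_of_nonneg (hg0 hs.le)]; exact hg1 hs.le)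
    have e2 : |L t| ≤ A t := intervalIntegral.abs_integral_le_integral_abs h0'
    rw [ht] at e1
    linarith [(abs_le.1 e1).1, (abs_le.1 e2).2]
  have hcP : ∀ t, 0 < t → c * P t ≤ 2 * A t := fun t ht =>
    le_of_ae_le_of_continuousOn (by fun_prop) (hAc.const_mul 2) bound1 ht
  have hPmono : ∀ a b, 0 ≤ a → a ≤ b → P a ≤ P b := by
    intro a b ha hab
    have : 0 ≤ ∫ u in a..b, g u := intervalIntegral.integral_nonneg hab
      fun u hu => hg0 (ha.trans hu.1)
    have h2 := intervalIntegral.integral_add_adjacent_intervals (hg.intervalIntegrable 0 a)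
      (hg.intervalIntegrable a b) (μ := volume)
    simp only [hP]
    linarith
  have hP0 : P 0 = 0 := by simp [hP]
  -- second identity
  have id2 : ∀ᵐ t ∂vol₊, (∫ s in (0 : ℝ)..t, L s) - ∫ s in (0 : ℝ)..t, c * P s
      = halfConv ℓ P t := by
    filter_upwards [halfConv_assoc one hl hgli, halfConv_assoc hl one hgli,
      ae_restrict_mem measurableSet_Ioi] with t e1 e2 h0
    have h0' : (0 : ℝ) ≤ t := le_of_lt h0
    have e3 : halfConv (fun _ => 1) ℓ = halfConv ℓ (fun _ => 1) := by
      ext s; exact halfConv_comm _ _ _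
    have e4 : halfConv (fun _ => 1) g = P := by
      ext s; exact one_halfConv _ _
    rw [e3, e2, e4, halfConv_congr_right id1 h0', one_halfConv] at e1
    rw [e1, ← intervalIntegral.integral_sub]
    · congr 1
      ext s
      ring
    · exact intervalIntegrable_of_locallyIntegrableOn hLli le_rfl h0'
    · exact (hPc.const_mul c).intervalIntegrable _ _
  refine ⟨fun t => c * P (max t 0), by fun_prop, fun a b hab => ?_, fun t ht => ?_⟩
  · exact mul_le_mul_of_nonneg_left
      (hPmono _ _ (le_max_right _ _) (max_le_max_right _ hab)) hc0.le
  have hrepl : (∫ s in (0 : ℝ)..t, c * P (max s 0)) = ∫ s in (0 : ℝ)..t, c * P s := by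
    apply intervalIntegral.integral_congr
    intro s hs
    rw [uIcc_of_le ht.le] at hs
    simp only [max_eq_left hs.1]
  rw [hrepl]
  have hQc : ContinuousOn (fun t => |(∫ s in (0 : ℝ)..t, L s) - ∫ s in (0 : ℝ)..t, c * P s|)
      (Ioi 0) := by
    refine ContinuousOn.abs (ContinuousOn.sub
      ((continuousOn_primitive_halfLine hLli).mono Ioi_subset_Ici_self) ?_)
    exact (intervalIntegral.continuous_primitive
      (fun a b => (hPc.const_mul c).intervalIntegrable a b) 0).continuousOn
  refine le_of_ae_le_of_continuousOn (g := fun t => 2 * A t ^ 2 / c) hQc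
    (((hAc.pow 2).const_mul 2).div_const c) ?_ ht
  filter_upwards [id2, ae_restrict_mem measurableSet_Ioi] with t ht h0
  have h0' : (0 : ℝ) ≤ t := le_of_lt h0
  rw [ht]
  refine (abs_halfConv_le (C := P t) hl h0' fun s hs hst => ?_).trans ?_
  · rw [abs_of_nonneg (hP0 ▸ hPmono 0 s le_rfl hs.le)]
    exact hPmono s t hs.le hst.le
  · rw [le_div_iff₀ hc0]
    have hA0 : 0 ≤ A t := intervalIntegral.integral_nonneg h0' fun _ _ => abs_nonneg _
    have := mul_le_mul_of_nonneg_left (hcP t h0) hA0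
    calc A t * P t * c = A t * (c * P t) := by ring
      _ ≤ A t * (2 * A t) := this
      _ = 2 * A t ^ 2 := by ring

theorem convexOn_primitive_of_monotone {G : ℝ → ℝ} (hG : Continuous G) (hm : Monotone G) :
    ConvexOn ℝ (Ioi 0) fun t => ∫ s in (0 : ℝ)..t, G s := by
  have hd : ∀ t, HasDerivAt (fun t => ∫ s in (0 : ℝ)..t, G s) (G t) t := fun t =>
    intervalIntegral.integral_hasDerivAt_right (hG.intervalIntegrable _ _)
      (hG.stronglyMeasurableAtFilter _ _) hG.continuousAt
  apply MonotoneOn.convexOn_of_deriv (convex_Ioi 0)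
  · exact fun t _ => (hd t).continuousAt.continuousWithinAt
  · exact fun t _ => (hd t).differentiableAt.differentiableWithinAt
  · intro a _ b _ hab
    rw [(hd a).deriv, (hd b).deriv]
    exact hm hab

/-- The second kernel of a pair in the class `(PC)` is nonnegative. -/
theorem IsPC.right_nonneg {k ℓ : ℝ → ℝ} (h : IsPC k ℓ) : ∀ᵐ t ∂vol₊, 0 ≤ ℓ t := by
  choose G hGc hGm hG using h.exists_approx
  have hl := h.locallyIntegrable_right
  set L : ℝ → ℝ := fun t => ∫ u in (0 : ℝ)..t, ℓ u with hL
  have hLc : ContinuousOn L (Ici 0) := continuousOn_primitive_halfLine hl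
  have hlim : ∀ t, 0 < t → Tendsto (fun n : ℕ => ∫ s in (0 : ℝ)..t, G n s) atTop
      (𝓝 (∫ s in (0 : ℝ)..t, L s)) := by
    intro t ht
    rw [tendsto_iff_dist_tendsto_zero]
    refine squeeze_zero (fun _ => dist_nonneg) (fun n => ?_)
      (tendsto_const_nhds (x := 2 * (∫ s in (0 : ℝ)..t, |ℓ s|) ^ 2).div_atTop
        (tendsto_natCast_atTop_atTop.atTop_add (tendsto_const_nhds (x := (1 : ℝ)))))
    rw [dist_comm, Real.dist_eq]
    exact hG n t ht
  have hconv : ConvexOn ℝ (Ioi 0) fun t => ∫ s in (0 : ℝ)..t, L s := by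
    refine ⟨convex_Ioi 0, fun x hx y hy a b ha hb hab => ?_⟩
    exact le_of_tendsto_of_tendsto' (hlim _ (convex_Ioi 0 hx hy ha hb hab))
      (((hlim x hx).const_smul a).add ((hlim y hy).const_smul b))
      fun n => (convexOn_primitive_of_monotone (hGc n) (hGm n)).2 hx hy ha hb hab
  have hd : ∀ t ∈ Ioi (0 : ℝ), HasDerivAt (fun t => ∫ s in (0 : ℝ)..t, L s) (L t) t := by
    intro t ht
    have ht' : (0 : ℝ) < t := ht
    apply intervalIntegral.integral_hasDerivAt_right
    · exact intervalIntegrable_of_locallyIntegrableOn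
        (hLc.locallyIntegrableOn measurableSet_Ici) le_rfl ht'.le
    · exact (hLc.mono Ioi_subset_Ici_self).stronglyMeasurableAtFilter isOpen_Ioi t ht
    · exact hLc.continuousAt (Ici_mem_nhds ht')
  have hmono : MonotoneOn L (Ioi 0) := by
    intro a ha b hb hab
    have := hconv.monotoneOn_deriv (fun x hx => (hd x hx).differentiableAt) ha hb hab
    rwa [(hd a ha).deriv, (hd b hb).deriv] at this
  filter_upwards [ae_hasDerivAt_primitive hl, ae_restrict_mem measurableSet_Ioi] with t ht h0
  have h1 : HasDerivWithinAt L (ℓ t) (Ioi 0) t := ht.hasDerivWithinAt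
  rw [← h1.derivWithin (isOpen_Ioi.uniqueDiffWithinAt h0)]
  exact hmono.derivWithin_nonneg

/-- The integral resolvent of the second kernel of a `(PC)` pair `(k, ℓ)` is the second kernel of
the `(PC)` pair `(k + η, r)`. -/
theorem IsIntegralResolvent.isPC {k ℓ r : ℝ → ℝ} {η : ℝ} (hη : 0 < η) (h : IsPC k ℓ)
    (hr : IsIntegralResolvent η ℓ r) : IsPC (fun t => k t + η) r where
  locallyIntegrable_left := h.locallyIntegrable_left.add (locallyIntegrableOn_const_halfLine η)
  nonneg t ht := add_nonneg (h.nonneg t ht) hη.le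
  antitone a ha b hb hab := by
    have := h.antitone ha hb hab
    simp only
    linarith
  locallyIntegrable_right := hr.locallyIntegrable
  conv_eq_one := by
    have hk := h.locallyIntegrable_left
    have hl := h.locallyIntegrable_right
    have hrl := hr.locallyIntegrable
    have hconv := locallyIntegrableOn_halfConv hrl hl
    have hconv' : LocallyIntegrableOn (fun t => η * halfConv r ℓ t) (Ici 0) := fun x hx => by
      obtain ⟨s, hs, h⟩ := hconv x hx
      exact ⟨s, hs, h.const_mul η⟩
    filter_upwards [halfConv_add_left hrl hk (locallyIntegrableOn_const_halfLine η),
      halfConv_add_right hk hrl hconv', halfConv_assoc hk hl hrl, h.conv_eq_one,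
      ae_restrict_mem measurableSet_Ioi] with t e1 e2 e3 e4 h0
    have h0' : (0 : ℝ) ≤ t := le_of_lt h0
    have e5 := halfConv_congr_right (f := k) hr.equation h0'
    have e6 : halfConv r ℓ = halfConv ℓ r := by
      ext s; exact halfConv_comm _ _ _
    have e7 : halfConv (fun _ => η) r t = η * halfConv (fun _ => 1) r t := by
      rw [← halfConv_const_mul_left]; simp
    rw [e1, e7, ← halfConv_congr_left h.conv_eq_one h0', e3, ← e4, ← e5, e2,
      halfConv_const_mul_right, e6]

theorem halfConv_exp_mul (f g : ℝ → ℝ) (l t : ℝ) :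
    halfConv (fun s => Real.exp (-l * s) * f s) (fun s => Real.exp (-l * s) * g s) t
      = Real.exp (-l * t) * halfConv f g t := by
  unfold halfConv
  rw [← intervalIntegral.integral_const_mul]
  refine intervalIntegral.integral_congr fun s _ => ?_
  have : Real.exp (-l * t) = Real.exp (-l * (t - s)) * Real.exp (-l * s) := by
    rw [← Real.exp_add]; ring_nf
  simp only [this]
  ring

theorem lineConv_indicator_exp (f g : ℝ → ℝ) (l : ℝ) :
    lineConv ((Ioi (0 : ℝ)).indicator fun s => Real.exp (-l * s) * f s)
      ((Ioi (0 : ℝ)).indicator fun s => Real.exp (-l * s) * g s)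
      = (Ioi (0 : ℝ)).indicator fun s => Real.exp (-l * s) * halfConv f g s := by
  ext t
  have h : ∀ f : ℝ → ℝ, ExtendsBelow (t + 1) ((Ioi (0 : ℝ)).indicator f) f := fun f s _ => rfl
  rw [(h _).lineConv (h _) t (Or.inr (by linarith))]
  refine indicator_eq_indicator (by rfl) ?_
  exact halfConv_exp_mul _ _ _ _

theorem integrableOn_exp_mul_halfConv {f g : ℝ → ℝ} {l : ℝ}
    (hf : IntegrableOn (fun t => Real.exp (-l * t) * f t) (Ioi 0))
    (hg : IntegrableOn (fun t => Real.exp (-l * t) * g t) (Ioi 0)) :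
    IntegrableOn (fun t => Real.exp (-l * t) * halfConv f g t) (Ioi 0) := by
  rw [← integrable_indicator_iff measurableSet_Ioi] at hf hg ⊢
  rw [← lineConv_indicator_exp]
  exact integrable_lineConv hf hg

theorem halfLaplace_halfConv {f g : ℝ → ℝ} {l : ℝ}
    (hf : IntegrableOn (fun t => Real.exp (-l * t) * f t) (Ioi 0))
    (hg : IntegrableOn (fun t => Real.exp (-l * t) * g t) (Ioi 0)) :
    halfLaplace (halfConv f g) l = halfLaplace f l * halfLaplace g l := by
  rw [← integrable_indicator_iff measurableSet_Ioi] at hf hg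
  unfold halfLaplace
  rw [← integral_indicator measurableSet_Ioi, ← integral_indicator measurableSet_Ioi,
    ← integral_indicator measurableSet_Ioi, ← lineConv_indicator_exp]
  exact integral_convolution (ContinuousLinearMap.mul ℝ ℝ) hf hg

theorem integrableOn_Ioi_of_bounded {f : ℝ → ℝ} (hf : LocallyIntegrableOn f (Ici 0))
    (h0 : ∀ᵐ t ∂vol₊, 0 ≤ f t) {C : ℝ} (hC : ∀ T, 0 < T → ∫ t in (0 : ℝ)..T, f t ≤ C) :
    IntegrableOn f (Ioi 0) := by
  apply integrableOn_Ioi_of_intervalIntegral_norm_bounded (l := atTop) (b := fun n : ℕ => (n : ℝ))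
    C 0
  · intro n
    rw [integrableOn_Ioc_iff_integrableOn_Ioo]
    exact locallyIntegrableOn_Ici_zero_iff.1 hf n
  · exact tendsto_natCast_atTop_atTop
  · filter_upwards [eventually_gt_atTop 0] with n hn
    have hn' : (0 : ℝ) < n := by exact_mod_cast hn
    refine le_trans (le_of_eq ?_) (hC n hn')
    rw [intervalIntegral.integral_of_le hn'.le, intervalIntegral.integral_of_le hn'.le]
    apply integral_congr_ae
    filter_upwards [ae_mono (Measure.restrict_mono Ioc_subset_Ioi_self le_rfl) h0] with t ht
    exact Real.norm_of_nonneg ht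

theorem halfLaplace_nonneg {f : ℝ → ℝ} (h0 : ∀ᵐ t ∂vol₊, 0 ≤ f t) (l : ℝ) :
    0 ≤ halfLaplace f l :=
  integral_nonneg_of_ae (h0.mono fun _ ht => mul_nonneg (Real.exp_pos _).le ht)

theorem IsPC.halfLaplace_left_pos {k ℓ : ℝ → ℝ} (h : IsPC k ℓ) {l : ℝ} (hl : 0 < l) :
    0 < halfLaplace k l := by
  have hk0 : ∀ᵐ t ∂vol₊, 0 ≤ k t := by
    filter_upwards [ae_restrict_mem measurableSet_Ioi] with t ht using h.nonneg t ht
  refine lt_of_le_of_ne (halfLaplace_nonneg hk0 l) fun h0 => ?_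
  have h1 := (integral_eq_zero_iff_of_nonneg_ae
    (hk0.mono fun t ht => mul_nonneg (Real.exp_pos (-l * t)).le ht)
    (integrableOn_exp_mul_of_antitone h.locallyIntegrable_left h.nonneg h.antitone hl)).1 h0.symm
  have h2 : k =ᵐ[vol₊] fun _ => 0 := by
    filter_upwards [h1] with t ht
    simpa using ht
  have h3 : ∀ᵐ t ∂vol₊, False := by
    filter_upwards [h.conv_eq_one, ae_restrict_mem measurableSet_Ioi] with t ht h0
    rw [halfConv_congr_left h2 (le_of_lt h0)] at ht
    simp [halfConv] at ht
  rw [ae_iff] at h3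
  simp at h3

theorem locallyIntegrableOn_exp_mul {f : ℝ → ℝ} (hf : LocallyIntegrableOn f (Ici 0)) (l : ℝ) :
    LocallyIntegrableOn (fun t => Real.exp (-l * t) * f t) (Ici 0) := by
  rw [locallyIntegrableOn_iff isClosed_Ici.isLocallyClosed] at hf ⊢
  intro K hK hKc
  exact (hf K hK hKc).continuousOn_mul (by fun_prop) hKc

theorem IsPC.integrableOn_exp_mul_right {k ℓ : ℝ → ℝ} (h : IsPC k ℓ) {l : ℝ} (hl : 0 < l) :
    IntegrableOn (fun t => Real.exp (-l * t) * ℓ t) (Ioi 0) := by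
  have hk := h.locallyIntegrable_left
  have hℓ := h.locallyIntegrable_right
  have hk0 : ∀ᵐ t ∂vol₊, 0 ≤ k t := by
    filter_upwards [ae_restrict_mem measurableSet_Ioi] with t ht using h.nonneg t ht
  have hpos := h.halfLaplace_left_pos hl
  have hexp : IntegrableOn (fun t => Real.exp (-l * t)) (Ioi 0) := exp_neg_integrableOn_Ioi 0 hl
  refine integrableOn_Ioi_of_bounded (locallyIntegrableOn_exp_mul hℓ l)
    (h.right_nonneg.mono fun t ht => mul_nonneg (Real.exp_pos _).le ht)
    (C := (∫ t in Ioi (0 : ℝ), Real.exp (-l * t)) / halfLaplace k l) fun T hT => ?_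
  have hsplit : ∀ S : Set ℝ, MeasurableSet S → LocallyIntegrableOn (S.indicator ℓ) (Ici 0) := by
    intro S hS
    rw [locallyIntegrableOn_Ici_zero_iff] at hℓ ⊢
    exact fun T => (hℓ T).indicator hS
  have hnn : ∀ S : Set ℝ, ∀ᵐ t ∂vol₊, 0 ≤ S.indicator ℓ t := fun S =>
    h.right_nonneg.mono fun t ht => indicator_apply_nonneg fun _ => ht
  have hle : ∀ᵐ t ∂vol₊, halfConv k ((Iic T).indicator ℓ) t ≤ 1 := by
    filter_upwards [h.conv_eq_one, halfConv_add_right hk (hsplit (Iic T) measurableSet_Iic)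
      (hsplit (Iic T)ᶜ measurableSet_Iic.compl), ae_restrict_mem measurableSet_Ioi]
      with t e1 e2 h0
    have e3 : (fun s => (Iic T).indicator ℓ s + (Iic T)ᶜ.indicator ℓ s) = ℓ :=
      indicator_self_add_compl (Iic T) ℓ
    rw [e3, e1] at e2
    have := halfConv_nonneg hk0 (hnn (Iic T)ᶜ) (le_of_lt h0)
    linarith
  have hkint := integrableOn_exp_mul_of_antitone hk h.nonneg h.antitone hl
  have hfun : (fun t => Real.exp (-l * t) * (Iic T).indicator ℓ t)
      = (Iic T).indicator fun t => Real.exp (-l * t) * ℓ t := by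
    ext t
    by_cases ht : t ∈ Iic T
    · rw [indicator_of_mem ht, indicator_of_mem ht]
    · rw [indicator_of_notMem ht, indicator_of_notMem ht, mul_zero]
  have hTint : IntegrableOn (fun t => Real.exp (-l * t) * (Iic T).indicator ℓ t) (Ioi 0) := by
    rw [hfun, IntegrableOn, integrable_indicator_iff measurableSet_Iic, IntegrableOn,
      Measure.restrict_restrict measurableSet_Iic, inter_comm, Ioi_inter_Iic]
    rw [← IntegrableOn, integrableOn_Ioc_iff_integrableOn_Ioo]
    exact locallyIntegrableOn_Ici_zero_iff.1 (locallyIntegrableOn_exp_mul hℓ l) T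
  have hval : halfLaplace ((Iic T).indicator ℓ) l = ∫ t in (0 : ℝ)..T, Real.exp (-l * t) * ℓ t := by
    rw [halfLaplace, hfun, integral_indicator measurableSet_Iic,
      Measure.restrict_restrict measurableSet_Iic, inter_comm, Ioi_inter_Iic,
      intervalIntegral.integral_of_le hT.le]
  rw [← hval, le_div_iff₀ hpos, mul_comm, ← halfLaplace_halfConv hkint hTint]
  apply integral_mono_ae (integrableOn_exp_mul_halfConv hkint hTint) hexp
  filter_upwards [hle] with t ht
  exact mul_le_of_le_one_right (Real.exp_pos _).le ht

theorem IsIntegralResolvent.halfLaplace_eq {k ℓ r : ℝ → ℝ} {η : ℝ} (hη : 0 < η) (h : IsPC k ℓ)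
    (hr : IsIntegralResolvent η ℓ r) {l : ℝ} (hl : 0 < l) :
    halfLaplace r l * (1 + η * halfLaplace ℓ l) = halfLaplace ℓ l := by
  have h1 := h.integrableOn_exp_mul_right hl
  have h2 := (hr.isPC hη h).integrableOn_exp_mul_right hl
  have h3 := integrableOn_exp_mul_halfConv h2 h1
  have h4 : halfLaplace ℓ l = halfLaplace r l + η * halfLaplace (halfConv r ℓ) l := by
    unfold halfLaplace
    rw [← integral_const_mul, ← integral_add h2 (h3.const_mul η)]
    apply integral_congr_ae
    filter_upwards [hr.equation] with t ht
    rw [← ht]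
    ring
  rw [halfLaplace_halfConv h2 h1] at h4
  linear_combination -h4

theorem halfLaplace_le_of_le {f : ℝ → ℝ} (h0 : ∀ᵐ t ∂vol₊, 0 ≤ f t)
    (hint : ∀ l, 0 < l → IntegrableOn (fun t => Real.exp (-l * t) * f t) (Ioi 0)) {a b : ℝ}
    (ha : 0 < a) (hab : a ≤ b) : halfLaplace f b ≤ halfLaplace f a := by
  apply integral_mono_ae (hint b (ha.trans_le hab)) (hint a ha)
  filter_upwards [h0, ae_restrict_mem measurableSet_Ioi] with t ht h0t
  apply mul_le_mul_of_nonneg_right _ ht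
  exact Real.exp_le_exp.2 (by nlinarith [mem_Ioi.1 h0t])

theorem tendsto_halfLaplace_atTop_of_not_integrable {f : ℝ → ℝ}
    (hf : LocallyIntegrableOn f (Ici 0)) (h0 : ∀ᵐ t ∂vol₊, 0 ≤ f t)
    (hint : ∀ l, 0 < l → IntegrableOn (fun t => Real.exp (-l * t) * f t) (Ioi 0))
    (hnot : ¬ IntegrableOn f (Ioi 0)) : Tendsto (halfLaplace f) (𝓝[>] 0) atTop := by
  rw [tendsto_atTop]
  intro C
  have hex : ∃ a, 0 < a ∧ C ≤ halfLaplace f a := by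
    by_contra! hcon
    refine hnot (integrableOn_Ioi_of_bounded hf h0 (C := Real.exp 1 * C) fun T hT => ?_)
    refine le_trans ?_ (mul_le_mul_of_nonneg_left (hcon T⁻¹ (inv_pos.2 hT)).le (Real.exp_pos 1).le)
    rw [halfLaplace, ← integral_const_mul, intervalIntegral.integral_of_le hT.le]
    have hi := (hint T⁻¹ (inv_pos.2 hT)).const_mul (Real.exp 1)
    refine le_trans (integral_mono_ae (g := fun t => Real.exp 1 * (Real.exp (-T⁻¹ * t) * f t))
      ?_ (hi.mono_measure (Measure.restrict_mono Ioc_subset_Ioi_self le_rfl)) ?_) ?_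
    · have := intervalIntegrable_of_locallyIntegrableOn hf le_rfl hT.le
      rwa [intervalIntegrable_iff_integrableOn_Ioc_of_le hT.le] at this
    · filter_upwards [ae_mono (Measure.restrict_mono Ioc_subset_Ioi_self le_rfl) h0,
        ae_restrict_mem measurableSet_Ioc] with t ht htT
      rw [← mul_assoc, ← Real.exp_add]
      apply le_mul_of_one_le_left ht
      apply Real.one_le_exp
      have : T⁻¹ * t ≤ 1 := by
        rw [inv_mul_le_iff₀ hT]; linarith [htT.2]
      linarith
    · apply setIntegral_mono_set hi _ (LE.le.eventuallyLE Ioc_subset_Ioi_self)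
      filter_upwards [h0] with t ht
      exact mul_nonneg (Real.exp_pos 1).le (mul_nonneg (Real.exp_pos _).le ht)
  obtain ⟨a, ha, hCa⟩ := hex
  filter_upwards [Ioo_mem_nhdsGT ha] with l hl
  exact hCa.trans (halfLaplace_le_of_le h0 hint hl.1 hl.2.le)

theorem exists_continuous_comp_exp_neg {H : ℝ → ℝ} (hH : Continuous H) {c : ℝ}
    (hc : ∀ s, c ≤ s → H s = 0) :
    ∃ q : ℝ → ℝ, Continuous q ∧ ∀ s, q (Real.exp (-s)) = H s := by
  refine ⟨fun x => if 0 < x then H (-Real.log x) else 0, ?_, fun s => ?_⟩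
  · rw [continuous_iff_continuousAt]
    intro x
    by_cases hx : 0 < x
    · have h1 : ContinuousAt (fun x => H (-Real.log x)) x :=
        hH.continuousAt.comp (Real.continuousAt_log hx.ne').neg
      refine h1.congr ?_
      filter_upwards [Ioi_mem_nhds hx] with y hy
      rw [if_pos (mem_Ioi.1 hy)]
    · refine (continuousAt_const (y := (0 : ℝ))).congr ?_
      filter_upwards [Iio_mem_nhds ((not_lt.1 hx).trans_lt (Real.exp_pos (-c)))] with y hy
      by_cases h0 : 0 < y
      · rw [if_pos h0, hc]
        have := (Real.log_lt_iff_lt_exp h0).2 hy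
        linarith
      · rw [if_neg h0]
  · simp [Real.exp_pos]

theorem integrable_exp_neg_pow {P : Measure ℝ} [IsFiniteMeasure P] (hP : ∀ᵐ s ∂P, 0 ≤ s) (n : ℕ) :
    Integrable (fun s => Real.exp (-s) ^ n) P := by
  refine Integrable.of_bound (by fun_prop) 1 ?_
  filter_upwards [hP] with s hs
  rw [norm_pow, Real.norm_eq_abs, Real.abs_exp]
  exact pow_le_one₀ (Real.exp_pos _).le (Real.exp_le_one_iff.2 (by linarith))

theorem integral_polynomial_exp_neg {P : Measure ℝ} [IsFiniteMeasure P] (hP : ∀ᵐ s ∂P, 0 ≤ s)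
    (p : Polynomial ℝ) :
    Integrable (fun s => p.eval (Real.exp (-s))) P ∧
      ∫ s, p.eval (Real.exp (-s)) ∂P
        = ∑ n ∈ Finset.range (p.natDegree + 1), p.coeff n * ∫ s, Real.exp (-s) ^ n ∂P := by
  simp_rw [Polynomial.eval_eq_sum_range]
  refine ⟨integrable_finsetSum _ fun n _ => (integrable_exp_neg_pow hP n).const_mul _, ?_⟩
  rw [integral_finsetSum _ fun n _ => (integrable_exp_neg_pow hP n).const_mul _]
  simp_rw [integral_const_mul]

theorem abs_integral_sub_integral_polynomial_le {P : Measure ℝ} [IsProbabilityMeasure P]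
    (hP : ∀ᵐ s ∂P, 0 ≤ s) {H : ℝ → ℝ} (hH : Integrable H P) (p : Polynomial ℝ) {ε : ℝ}
    (hp : ∀ s, 0 ≤ s → |p.eval (Real.exp (-s)) - H s| ≤ ε) :
    |∫ s, p.eval (Real.exp (-s)) ∂P - ∫ s, H s ∂P| ≤ ε := by
  rw [← integral_sub (integral_polynomial_exp_neg hP p).1 hH, ← Real.norm_eq_abs]
  have := norm_integral_le_of_norm_le_const (μ := P) (C := ε)
    (f := fun s => p.eval (Real.exp (-s)) - H s) (hP.mono fun s hs => hp s hs)
  simpa using this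

/-- Convergence of the moments of `exp (-S)` implies vague convergence on the closed half-line. -/
theorem tendsto_integral_of_tendsto_exp_moments {ι : Type*} {F : Filter ι} {P : ι → Measure ℝ}
    {ν : Measure ℝ} [IsProbabilityMeasure ν]
    (hP : ∀ᶠ i in F, IsProbabilityMeasure (P i) ∧ ∀ᵐ s ∂(P i), 0 ≤ s) (hν : ∀ᵐ s ∂ν, 0 ≤ s)
    (hmom : ∀ n : ℕ, Tendsto (fun i => ∫ s, Real.exp (-s) ^ n ∂(P i)) F
      (𝓝 (∫ s, Real.exp (-s) ^ n ∂ν)))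
    {H : ℝ → ℝ} (hH : Continuous H) {c : ℝ} (hc : ∀ s, c ≤ s → H s = 0) :
    Tendsto (fun i => ∫ s, H s ∂(P i)) F (𝓝 (∫ s, H s ∂ν)) := by
  obtain ⟨q, hq, hqH⟩ := exists_continuous_comp_exp_neg hH hc
  obtain ⟨B, hB⟩ := isCompact_Icc.exists_bound_of_continuousOn (s := Icc (0 : ℝ) 1) hq.continuousOn
  have hmem : ∀ s : ℝ, 0 ≤ s → Real.exp (-s) ∈ Icc (0 : ℝ) 1 := fun s hs =>
    ⟨(Real.exp_pos _).le, Real.exp_le_one_iff.2 (by linarith)⟩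
  have hHint : ∀ (P : Measure ℝ) [IsProbabilityMeasure P], (∀ᵐ s ∂P, 0 ≤ s) → Integrable H P := by
    intro P _ hP
    refine Integrable.of_bound hH.aestronglyMeasurable B ?_
    filter_upwards [hP] with s hs
    rw [← hqH]
    exact hB _ (hmem s hs)
  rw [Metric.tendsto_nhds]
  intro ε hε
  obtain ⟨p, hp⟩ := exists_polynomial_near_of_continuousOn 0 1 q hq.continuousOn (ε / 3)
    (by positivity)
  have hp' : ∀ s, 0 ≤ s → |p.eval (Real.exp (-s)) - H s| ≤ ε / 3 := fun s hs => by
    rw [← hqH]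
    exact (hp _ (hmem s hs)).le
  have hpoly : Tendsto (fun i => ∑ n ∈ Finset.range (p.natDegree + 1),
      p.coeff n * ∫ s, Real.exp (-s) ^ n ∂(P i)) F (𝓝 (∫ s, p.eval (Real.exp (-s)) ∂ν)) := by
    rw [(integral_polynomial_exp_neg hν p).2]
    exact tendsto_finsetSum _ fun n _ => (hmom n).const_mul _
  filter_upwards [hP, Metric.tendsto_nhds.1 hpoly (ε / 3) (by positivity)] with i hi hi2
  obtain ⟨hi1, hi0⟩ := hi
  rw [← (integral_polynomial_exp_neg hi0 p).2, Real.dist_eq] at hi2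
  have e1 := abs_integral_sub_integral_polynomial_le hi0 (hHint _ hi0) p hp'
  have e2 := abs_integral_sub_integral_polynomial_le hν (hHint _ hν) p hp'
  rw [Real.dist_eq]
  rw [abs_le] at e1 e2
  rw [abs_lt] at hi2 ⊢
  constructor <;> linarith [e1.1, e1.2, e2.1, e2.2, hi2.1, hi2.2]

/-- The gamma law with shape `ρ` (a Dirac mass if `ρ = 0`). -/
theorem exists_gamma_law {ρ : ℝ} (hρ : 0 ≤ ρ) :
    ∃ ν : Measure ℝ, IsProbabilityMeasure ν ∧ (∀ᵐ s ∂ν, 0 ≤ s) ∧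
      (∀ n : ℕ, ∫ s, Real.exp (-s) ^ n ∂ν = ((n : ℝ) + 1) ^ (-ρ)) ∧
      ∀ b, 0 < b → ∫ s in Iic b, Real.exp s ∂ν = b ^ ρ / Real.Gamma (1 + ρ) := by
  rcases hρ.eq_or_lt with rfl | hρ
  · refine ⟨Measure.dirac 0, inferInstance, ?_, fun n => by simp, fun b hb => ?_⟩
    · rw [ae_dirac_iff measurableSet_Ici]
    · rw [← integral_indicator measurableSet_Iic, integral_dirac, indicator_of_mem (mem_Iic.2 hb.le)]
      simp
  have hae : ∀ᵐ s : ℝ, gammaPDF ρ 1 s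
      = ENNReal.ofReal ((Ioi (0 : ℝ)).indicator
        (fun s => (Real.Gamma ρ)⁻¹ * s ^ (ρ - 1) * Real.exp (-s)) s) := by
    have : ∀ᵐ s : ℝ, s ≠ 0 := by simp [ae_iff]
    filter_upwards [this] with s hs
    rcases lt_or_gt_of_ne hs with h | h
    · rw [gammaPDF_of_neg h, indicator_of_notMem (show s ∉ Ioi 0 from not_lt.2 h.le)]
      simp
    · rw [gammaPDF_of_nonneg h.le, indicator_of_mem (show s ∈ Ioi 0 from h)]
      simp
  have hnn : ∀ s : ℝ, 0 ≤ (Ioi (0 : ℝ)).indicator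
        (fun s => (Real.Gamma ρ)⁻¹ * s ^ (ρ - 1) * Real.exp (-s)) s := fun s =>
    indicator_nonneg (fun s hs => by
      have := Real.Gamma_pos_of_pos hρ
      have := Real.rpow_nonneg (le_of_lt hs) (ρ - 1)
      positivity) s
  have hmeas : Measurable fun s => (Ioi (0 : ℝ)).indicator
        (fun s => (Real.Gamma ρ)⁻¹ * s ^ (ρ - 1) * Real.exp (-s)) s := by
    apply Measurable.indicator _ measurableSet_Ioi
    fun_prop
  have hden : gammaMeasure ρ 1 = volume.withDensity fun s => ENNReal.ofReal
      ((Ioi (0 : ℝ)).indicator (fun s => (Real.Gamma ρ)⁻¹ * s ^ (ρ - 1) * Real.exp (-s)) s) :=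
    withDensity_congr_ae hae
  have hint : ∀ g : ℝ → ℝ, ∫ s, g s ∂(gammaMeasure ρ 1)
      = ∫ s in Ioi (0 : ℝ), (Real.Gamma ρ)⁻¹ * s ^ (ρ - 1) * Real.exp (-s) * g s := by
    intro g
    rw [hden, integral_withDensity_eq_integral_toReal_smul (by fun_prop)
      (ae_of_all _ fun s => ENNReal.ofReal_lt_top), ← integral_indicator measurableSet_Ioi]
    refine integral_congr_ae (ae_of_all _ fun s => ?_)
    simp only [smul_eq_mul]
    rw [ENNReal.toReal_ofReal (hnn s)]
    by_cases hs : s ∈ Ioi (0 : ℝ)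
    · rw [indicator_of_mem hs, indicator_of_mem hs]
    · rw [indicator_of_notMem hs, indicator_of_notMem hs, zero_mul]
  have hG := (Real.Gamma_pos_of_pos hρ).ne'
  refine ⟨gammaMeasure ρ 1, isProbabilityMeasure_gammaMeasure hρ one_pos, ?_, fun n => ?_,
    fun b hb => ?_⟩
  · rw [ae_iff, gammaMeasure, withDensity_apply _ (by measurability)]
    have : {a : ℝ | ¬ 0 ≤ a} = Iio 0 := by ext; simp
    rw [this]
    exact lintegral_gammaPDF_of_nonpos le_rfl
  · rw [hint]
    have e : ∀ s : ℝ, (Real.Gamma ρ)⁻¹ * s ^ (ρ - 1) * Real.exp (-s) * Real.exp (-s) ^ n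
        = (Real.Gamma ρ)⁻¹ * (s ^ (ρ - 1) * Real.exp (-(((n : ℝ) + 1) * s))) := by
      intro s
      rw [← Real.exp_nat_mul, mul_assoc _ (Real.exp _), ← Real.exp_add]
      ring_nf
    simp_rw [e]
    rw [integral_const_mul, Real.integral_rpow_mul_exp_neg_mul_Ioi hρ (by positivity)]
    rw [one_div, Real.inv_rpow (by positivity), Real.rpow_neg (by positivity)]
    field_simp
  · rw [← integral_indicator measurableSet_Iic, hint]
    have e : ∀ s : ℝ, (Real.Gamma ρ)⁻¹ * s ^ (ρ - 1) * Real.exp (-s)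
        * (Iic b).indicator (fun s => Real.exp s) s
        = (Iic b).indicator (fun s => (Real.Gamma ρ)⁻¹ * s ^ (ρ - 1)) s := by
      intro s
      by_cases hs : s ∈ Iic b
      · rw [indicator_of_mem hs, indicator_of_mem hs, mul_assoc, ← Real.exp_add]
        simp
      · rw [indicator_of_notMem hs, indicator_of_notMem hs, mul_zero]
    simp_rw [e]
    rw [integral_indicator measurableSet_Iic, Measure.restrict_restrict measurableSet_Iic,
      inter_comm, Ioi_inter_Iic, ← intervalIntegral.integral_of_le hb.le,
      intervalIntegral.integral_const_mul, integral_rpow (Or.inl (by linarith)),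
      Real.zero_rpow (by linarith), add_comm 1 ρ, Real.Gamma_add_one hρ.ne']
    simp only [sub_add_cancel, sub_zero]
    field_simp

/-- A continuous function equal to `1` up to `a` and to `0` after `a + δ`. -/
def ramp (a δ s : ℝ) : ℝ := max 0 (min 1 ((a + δ - s) / δ))

theorem continuous_ramp (a δ : ℝ) : Continuous (ramp a δ) := by
  unfold ramp
  fun_prop

theorem ramp_nonneg (a δ s : ℝ) : 0 ≤ ramp a δ s := le_max_left _ _

theorem ramp_le_one (a δ s : ℝ) : ramp a δ s ≤ 1 := max_le zero_le_one (min_le_left _ _)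

theorem ramp_eq_one {a δ s : ℝ} (hδ : 0 < δ) (hs : s ≤ a) : ramp a δ s = 1 := by
  have : 1 ≤ (a + δ - s) / δ := by rw [le_div_iff₀ hδ]; linarith
  simp [ramp, min_eq_left this]

theorem ramp_eq_zero {a δ s : ℝ} (hδ : 0 < δ) (hs : a + δ ≤ s) : ramp a δ s = 0 := by
  have : (a + δ - s) / δ ≤ 0 := div_nonpos_of_nonpos_of_nonneg (by linarith) hδ.le
  rw [ramp, max_eq_left ((min_le_right _ _).trans this)]

/-- The law of `l T`, where `T` has the density proportional to `exp (-l t) f t`. -/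
def scaledLaw (f : ℝ → ℝ) (l : ℝ) : Measure ℝ :=
  (vol₊.withDensity fun t =>
    ENNReal.ofReal (Real.exp (-l * t) * f t / halfLaplace f l)).map fun t => l * t

section ScaledLaw

variable {f : ℝ → ℝ} {l : ℝ}

theorem scaledLaw_density_nonneg (h0 : ∀ᵐ t ∂vol₊, 0 ≤ f t) :
    ∀ᵐ t ∂vol₊, 0 ≤ Real.exp (-l * t) * f t / halfLaplace f l :=
  h0.mono fun _ ht => div_nonneg (mul_nonneg (Real.exp_pos _).le ht) (halfLaplace_nonneg h0 l)

theorem integral_scaledLaw (h0 : ∀ᵐ t ∂vol₊, 0 ≤ f t)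
    (hint : IntegrableOn (fun t => Real.exp (-l * t) * f t) (Ioi 0)) {H : ℝ → ℝ}
    (hH : Continuous H) :
    ∫ s, H s ∂(scaledLaw f l)
      = (∫ t in Ioi (0 : ℝ), Real.exp (-l * t) * f t * H (l * t)) / halfLaplace f l := by
  rw [scaledLaw, integral_map (by fun_prop) hH.aestronglyMeasurable,
    integral_withDensity_eq_integral_toReal_smul₀ (hint.div_const _).aemeasurable.ennreal_ofReal
    (ae_of_all _ fun s => ENNReal.ofReal_lt_top), ← integral_div]
  apply integral_congr_ae
  filter_upwards [scaledLaw_density_nonneg (l := l) h0] with t ht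
  rw [ENNReal.toReal_ofReal ht, smul_eq_mul]
  ring

theorem isProbabilityMeasure_scaledLaw (h0 : ∀ᵐ t ∂vol₊, 0 ≤ f t)
    (hint : IntegrableOn (fun t => Real.exp (-l * t) * f t) (Ioi 0)) (hpos : 0 < halfLaplace f l) :
    IsProbabilityMeasure (scaledLaw f l) := by
  have : IsProbabilityMeasure (vol₊.withDensity fun t =>
      ENNReal.ofReal (Real.exp (-l * t) * f t / halfLaplace f l)) := by
    constructor
    rw [withDensity_apply _ MeasurableSet.univ, Measure.restrict_univ,
      ← ofReal_integral_eq_lintegral_ofReal (hint.div_const _) (scaledLaw_density_nonneg h0),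
      integral_div]
    change ENNReal.ofReal (halfLaplace f l / halfLaplace f l) = 1
    rw [div_self hpos.ne', ENNReal.ofReal_one]
  exact Measure.isProbabilityMeasure_map (by fun_prop)

theorem scaledLaw_nonneg (hl : 0 < l) : ∀ᵐ s ∂(scaledLaw f l), 0 ≤ s := by
  rw [scaledLaw, ae_map_iff (by fun_prop) measurableSet_Ici]
  refine (withDensity_absolutelyContinuous _ _).ae_le ?_
  filter_upwards [ae_restrict_mem measurableSet_Ioi] with t ht
  exact mul_nonneg hl.le (le_of_lt ht)

theorem integral_exp_neg_pow_scaledLaw (h0 : ∀ᵐ t ∂vol₊, 0 ≤ f t)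
    (hint : IntegrableOn (fun t => Real.exp (-l * t) * f t) (Ioi 0)) (n : ℕ) :
    ∫ s, Real.exp (-s) ^ n ∂(scaledLaw f l)
      = halfLaplace f (l * (n + 1)) / halfLaplace f l := by
  rw [integral_scaledLaw h0 hint (H := fun s => Real.exp (-s) ^ n) (by fun_prop)]
  congr 1
  refine integral_congr_ae (ae_of_all _ fun t => ?_)
  have : Real.exp (-(l * (n + 1)) * t) = Real.exp (-l * t) * Real.exp (-(l * t)) ^ n := by
    rw [← Real.exp_nat_mul, ← Real.exp_add]
    ring_nf
  simp only [this]
  ring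

theorem integral_ramp_scaledLaw (h0 : ∀ᵐ t ∂vol₊, 0 ≤ f t)
    (hint : IntegrableOn (fun t => Real.exp (-l * t) * f t) (Ioi 0)) (a δ : ℝ) :
    ∫ s, ramp a δ s * Real.exp s ∂(scaledLaw f l)
      = (∫ t in Ioi (0 : ℝ), ramp a δ (l * t) * f t) / halfLaplace f l := by
  rw [integral_scaledLaw h0 hint (H := fun s => ramp a δ s * Real.exp s)
    ((continuous_ramp a δ).mul Real.continuous_exp)]
  congr 1
  refine integral_congr_ae (ae_of_all _ fun t => ?_)
  have : Real.exp (-l * t) * Real.exp (l * t) = 1 := by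
    rw [← Real.exp_add]; simp
  simp only
  linear_combination (f t * ramp a δ (l * t)) * this

theorem integrableOn_ramp_mul (hint : IntegrableOn (fun t => Real.exp (-l * t) * f t) (Ioi 0))
    {a δ : ℝ} (hδ : 0 < δ) : IntegrableOn (fun t => ramp a δ (l * t) * f t) (Ioi 0) := by
  have h : (fun t => ramp a δ (l * t) * f t) = fun t => (ramp a δ (l * t) * Real.exp (l * t)) *
      (Real.exp (-l * t) * f t) := by
    ext t
    have : Real.exp (-l * t) * Real.exp (l * t) = 1 := by
      rw [← Real.exp_add]; simp
    linear_combination -(f t * ramp a δ (l * t)) * this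
  rw [h]
  have hc := continuous_ramp a δ
  refine Integrable.bdd_mul (c := Real.exp (a + δ)) hint (by fun_prop) (ae_of_all _ fun t => ?_)
  rw [norm_mul, Real.norm_of_nonneg (ramp_nonneg _ _ _), Real.norm_eq_abs, Real.abs_exp]
  by_cases ht : a + δ ≤ l * t
  · rw [ramp_eq_zero hδ ht, zero_mul]
    positivity
  · calc ramp a δ (l * t) * Real.exp (l * t) ≤ 1 * Real.exp (a + δ) := by
          gcongr
          · exact ramp_le_one _ _ _
          · exact (not_le.1 ht).le
      _ = _ := one_mul _

theorem primitive_le_integral_ramp (h0 : ∀ᵐ t ∂vol₊, 0 ≤ f t)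
    (hint : IntegrableOn (fun t => Real.exp (-l * t) * f t) (Ioi 0)) (hl : 0 < l)
    {δ : ℝ} (hδ : 0 < δ) :
    ∫ t in (0 : ℝ)..l⁻¹, f t ≤ ∫ t in Ioi (0 : ℝ), ramp 1 δ (l * t) * f t := by
  have hl' := inv_pos.2 hl
  rw [intervalIntegral.integral_of_le hl'.le]
  have h1 : ∫ t in Ioc 0 l⁻¹, f t = ∫ t in Ioc 0 l⁻¹, ramp 1 δ (l * t) * f t := by
    refine setIntegral_congr_fun measurableSet_Ioc fun t ht => ?_
    rw [ramp_eq_one hδ, one_mul]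
    rw [mul_comm, ← le_div_iff₀ hl, one_div]
    exact ht.2
  rw [h1]
  apply setIntegral_mono_set (integrableOn_ramp_mul hint hδ) _
    (LE.le.eventuallyLE Ioc_subset_Ioi_self)
  exact h0.mono fun t ht => mul_nonneg (ramp_nonneg _ _ _) ht

theorem integral_ramp_le_primitive (h0 : ∀ᵐ t ∂vol₊, 0 ≤ f t)
    (hf : LocallyIntegrableOn f (Ici 0)) (hl : 0 < l) {δ : ℝ} (hδ : 0 < δ) :
    ∫ t in Ioi (0 : ℝ), ramp (1 - δ) δ (l * t) * f t ≤ ∫ t in (0 : ℝ)..l⁻¹, f t := by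
  have hl' := inv_pos.2 hl
  have hfi := intervalIntegrable_of_locallyIntegrableOn hf le_rfl hl'.le
  rw [intervalIntegrable_iff_integrableOn_Ioc_of_le hl'.le] at hfi
  have hc := continuous_ramp (1 - δ) δ
  rw [intervalIntegral.integral_of_le hl'.le]
  have h1 : ∫ t in Ioi (0 : ℝ), ramp (1 - δ) δ (l * t) * f t
      = ∫ t in Ioc 0 l⁻¹, ramp (1 - δ) δ (l * t) * f t := by
    apply setIntegral_eq_of_subset_of_forall_sdiff_eq_zero measurableSet_Ioi Ioc_subset_Ioi_self
    intro t ht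
    have ht2 : l⁻¹ < t := by
      by_contra! h
      exact ht.2 ⟨ht.1, h⟩
    rw [ramp_eq_zero hδ, zero_mul]
    rw [sub_add_cancel]
    calc (1 : ℝ) = l * l⁻¹ := (mul_inv_cancel₀ hl.ne').symm
      _ ≤ l * t := by gcongr
  rw [h1]
  apply integral_mono_ae
  · refine Integrable.bdd_mul (c := 1) hfi (by fun_prop) (ae_of_all _ fun t => ?_)
    rw [Real.norm_of_nonneg (ramp_nonneg _ _ _)]
    exact ramp_le_one _ _ _
  · exact hfi
  · filter_upwards [ae_mono (Measure.restrict_mono Ioc_subset_Ioi_self le_rfl) h0] with t ht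
    exact mul_le_of_le_one_left ht (ramp_le_one _ _ _)

end ScaledLaw

theorem integrableOn_exp_Iic_of_isFiniteMeasure {ν : Measure ℝ} [IsFiniteMeasure ν] (b : ℝ) :
    IntegrableOn Real.exp (Iic b) ν := by
  refine Integrable.of_bound (by fun_prop) (Real.exp b) ?_
  filter_upwards [ae_restrict_mem measurableSet_Iic] with s hs
  rw [Real.norm_eq_abs, Real.abs_exp]
  exact Real.exp_le_exp.2 hs

theorem integral_ramp_bounds {ν : Measure ℝ} [IsFiniteMeasure ν] {a δ : ℝ} (hδ : 0 < δ) :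
    ∫ s in Iic a, Real.exp s ∂ν ≤ ∫ s, ramp a δ s * Real.exp s ∂ν ∧
      ∫ s, ramp a δ s * Real.exp s ∂ν ≤ ∫ s in Iic (a + δ), Real.exp s ∂ν := by
  have hi : ∀ b, Integrable ((Iic b).indicator Real.exp) ν := fun b =>
    (integrable_indicator_iff measurableSet_Iic).2 (integrableOn_exp_Iic_of_isFiniteMeasure b)
  have hub : ∀ s, ramp a δ s * Real.exp s ≤ (Iic (a + δ)).indicator Real.exp s := by
    intro s
    by_cases hs : s ≤ a + δ
    · rw [indicator_of_mem (mem_Iic.2 hs)]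
      exact mul_le_of_le_one_left (Real.exp_pos _).le (ramp_le_one _ _ _)
    · rw [ramp_eq_zero hδ (not_le.1 hs).le, zero_mul]
      exact indicator_nonneg (fun _ _ => (Real.exp_pos _).le) _
  have hnn : ∀ s, 0 ≤ ramp a δ s * Real.exp s := fun s =>
    mul_nonneg (ramp_nonneg _ _ _) (Real.exp_pos _).le
  have hr : Integrable (fun s => ramp a δ s * Real.exp s) ν := by
    have hc := continuous_ramp a δ
    refine (hi (a + δ)).mono' (by fun_prop) (ae_of_all _ fun s => ?_)
    rw [Real.norm_of_nonneg (hnn s)]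
    exact hub s
  rw [← integral_indicator measurableSet_Iic, ← integral_indicator measurableSet_Iic]
  refine ⟨integral_mono (hi a) hr fun s => ?_, integral_mono hr (hi _) hub⟩
  by_cases hs : s ≤ a
  · rw [indicator_of_mem (mem_Iic.2 hs), ramp_eq_one hδ hs, one_mul]
  · rw [indicator_of_notMem (show s ∉ Iic a from hs)]
    exact hnn s

/-- **Karamata's Tauberian theorem** for a measure with a density on the half-line. -/
theorem tendsto_primitive_div_halfLaplace {f : ℝ → ℝ} (hf : LocallyIntegrableOn f (Ici 0))
    (h0 : ∀ᵐ t ∂vol₊, 0 ≤ f t)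
    (hint : ∀ l, 0 < l → IntegrableOn (fun t => Real.exp (-l * t) * f t) (Ioi 0))
    {ρ : ℝ} (hρ : 0 ≤ ρ) {F : Filter ℝ} (hF : ∀ᶠ l in F, 0 < l)
    (hpos : ∀ l, 0 < l → 0 < halfLaplace f l)
    (hrv : ∀ x, 0 < x → Tendsto (fun l => halfLaplace f (l * x) / halfLaplace f l) F
      (𝓝 (x ^ (-ρ)))) :
    Tendsto (fun l => (∫ t in (0 : ℝ)..l⁻¹, f t) / halfLaplace f l) F
      (𝓝 (1 / Real.Gamma (1 + ρ))) := by
  obtain ⟨ν, hν, hν0, hνm, hνb⟩ := exists_gamma_law hρ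
  have hconv : ∀ a δ, 0 < δ → Tendsto (fun l => ∫ s, ramp a δ s * Real.exp s ∂(scaledLaw f l)) F
      (𝓝 (∫ s, ramp a δ s * Real.exp s ∂ν)) := by
    intro a δ hδ
    have hc := continuous_ramp a δ
    apply tendsto_integral_of_tendsto_exp_moments (c := a + δ) _ hν0 _ (by fun_prop)
    · intro s hs
      rw [ramp_eq_zero hδ hs, zero_mul]
    · filter_upwards [hF] with l hl
      exact ⟨isProbabilityMeasure_scaledLaw h0 (hint l hl) (hpos l hl), scaledLaw_nonneg hl⟩
    · intro n
      rw [hνm]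
      refine (hrv (n + 1) (by positivity)).congr' ?_
      filter_upwards [hF] with l hl
      exact (integral_exp_neg_pow_scaledLaw h0 (hint l hl) n).symm
  have hcont : ContinuousAt (fun b : ℝ => b ^ ρ / Real.Gamma (1 + ρ)) 1 :=
    (Real.continuousAt_rpow_const _ _ (Or.inl one_ne_zero)).div_const _
  have hval : (1 : ℝ) ^ ρ / Real.Gamma (1 + ρ) = 1 / Real.Gamma (1 + ρ) := by rw [Real.one_rpow]
  have hcont' : Tendsto (fun b : ℝ => b ^ ρ / Real.Gamma (1 + ρ)) (𝓝 1)
      (𝓝 (1 / Real.Gamma (1 + ρ))) := hval ▸ hcont.tendsto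
  have hminus : Tendsto (fun δ : ℝ => (1 - δ) ^ ρ / Real.Gamma (1 + ρ)) (𝓝[>] 0)
      (𝓝 (1 / Real.Gamma (1 + ρ))) := by
    refine hcont'.comp (tendsto_nhdsWithin_of_tendsto_nhds ?_)
    have : ContinuousAt (fun δ : ℝ => 1 - δ) 0 := by fun_prop
    simpa using this.tendsto
  have hplus : Tendsto (fun δ : ℝ => (1 + δ) ^ ρ / Real.Gamma (1 + ρ)) (𝓝[>] 0)
      (𝓝 (1 / Real.Gamma (1 + ρ))) := by
    refine hcont'.comp (tendsto_nhdsWithin_of_tendsto_nhds ?_)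
    have : ContinuousAt (fun δ : ℝ => 1 + δ) 0 := by fun_prop
    simpa using this.tendsto
  rw [tendsto_order]
  constructor
  · intro y hy
    obtain ⟨δ, hδy, hδ0, hδ1⟩ :=
      ((hminus.eventually_const_lt hy).and (Ioo_mem_nhdsGT one_pos)).exists
    have h1 : y < ∫ s, ramp (1 - δ) δ s * Real.exp s ∂ν := by
      refine lt_of_lt_of_le hδy ?_
      rw [← hνb _ (by linarith)]
      exact (integral_ramp_bounds hδ0).1
    filter_upwards [(hconv _ _ hδ0).eventually_const_lt h1, hF] with l hl hl0
    refine hl.trans_le ?_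
    rw [integral_ramp_scaledLaw h0 (hint l hl0)]
    exact div_le_div_of_nonneg_right (integral_ramp_le_primitive h0 hf hl0 hδ0)
      (hpos l hl0).le
  · intro y hy
    obtain ⟨δ, hδy, hδ0⟩ := ((hplus.eventually_lt_const hy).and self_mem_nhdsWithin).exists
    have hδ0' : (0 : ℝ) < δ := hδ0
    have h1 : ∫ s, ramp 1 δ s * Real.exp s ∂ν < y := by
      refine lt_of_le_of_lt (integral_ramp_bounds hδ0').2 ?_
      rw [hνb _ (by linarith)]
      exact hδy
    filter_upwards [(hconv _ _ hδ0').eventually_lt_const h1, hF] with l hl hl0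
    refine lt_of_le_of_lt ?_ hl
    rw [integral_ramp_scaledLaw h0 (hint l hl0)]
    exact div_le_div_of_nonneg_right (primitive_le_integral_ramp h0 (hint l hl0) hl0 hδ0')
      (hpos l hl0).le

theorem tendsto_primitive_div_of_halfLaplace_asymp {f h : ℝ → ℝ}
    (hf : LocallyIntegrableOn f (Ici 0)) (h0 : ∀ᵐ t ∂vol₊, 0 ≤ f t)
    (hint : ∀ l, 0 < l → IntegrableOn (fun t => Real.exp (-l * t) * f t) (Ioi 0))
    (hpos : ∀ l, 0 < l → 0 < halfLaplace f l) (hh : ∀ l, 0 < l → 0 < h l)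
    {ρ c : ℝ} (hc : 0 < c) {F : Filter ℝ} [F.NeBot] (hF : ∀ᶠ l in F, 0 < l)
    (hscale : ∀ x : ℝ, 0 < x → Tendsto (fun l => l * x) F F)
    (hlim : Tendsto (fun l => halfLaplace f l / h l) F (𝓝 c))
    (hrv : ∀ x, 0 < x → Tendsto (fun l => h (l * x) / h l) F (𝓝 (x ^ (-ρ)))) :
    Tendsto (fun l => (∫ t in (0 : ℝ)..l⁻¹, f t) / h l) F (𝓝 (c / Real.Gamma (1 + ρ))) := by
  have hrv' : ∀ x, 0 < x → Tendsto (fun l => halfLaplace f (l * x) / halfLaplace f l) F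
      (𝓝 (x ^ (-ρ))) := by
    intro x hx
    have := ((hlim.comp (hscale x hx)).mul (hrv x hx)).div hlim hc.ne'
    rw [mul_div_cancel_left₀ _ hc.ne'] at this
    refine this.congr' ?_
    filter_upwards [hF] with l hl
    have e1 := (hh l hl).ne'
    have e2 := (hh _ (mul_pos hl hx)).ne'
    have e3 := (hpos l hl).ne'
    simp only [Pi.div_apply, Function.comp_apply]
    field_simp
  have hρ : 0 ≤ ρ := by
    have h2 : (2 : ℝ) ^ (-ρ) ≤ 1 := by
      refine le_of_tendsto (hrv' 2 two_pos) ?_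
      filter_upwards [hF] with l hl
      rw [div_le_one (hpos l hl)]
      exact halfLaplace_le_of_le h0 hint hl (by linarith)
    by_contra! hneg
    exact absurd h2 (not_le.2 (Real.one_lt_rpow (by norm_num) (by linarith)))
  have hk := tendsto_primitive_div_halfLaplace hf h0 hint hρ hF hpos hrv'
  have := hk.mul hlim
  rw [one_div_mul_eq_div] at this
  refine this.congr' ?_
  filter_upwards [hF] with l hl
  have e1 := (hh l hl).ne'
  have e3 := (hpos l hl).ne'
  field_simp

section Resolvent

variable {k ℓ r : ℝ → ℝ} {η : ℝ}

theorem IsIntegralResolvent.locallyIntegrableOn_halfConv (h : IsPC k ℓ)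
    (hr : IsIntegralResolvent η ℓ r) : LocallyIntegrableOn (halfConv ℓ r) (Ici 0) :=
  _root_.locallyIntegrableOn_halfConv h.locallyIntegrable_right hr.locallyIntegrable

theorem IsIntegralResolvent.halfConv_nonneg (hη : 0 < η) (h : IsPC k ℓ)
    (hr : IsIntegralResolvent η ℓ r) : ∀ᵐ t ∂vol₊, 0 ≤ halfConv ℓ r t := by
  filter_upwards [ae_restrict_mem measurableSet_Ioi] with t ht
  exact _root_.halfConv_nonneg h.right_nonneg (hr.isPC hη h).right_nonneg (le_of_lt ht)

theorem IsIntegralResolvent.integrableOn_exp_mul_halfConv (hη : 0 < η) (h : IsPC k ℓ)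
    (hr : IsIntegralResolvent η ℓ r) {l : ℝ} (hl : 0 < l) :
    IntegrableOn (fun t => Real.exp (-l * t) * halfConv ℓ r t) (Ioi 0) :=
  _root_.integrableOn_exp_mul_halfConv (h.integrableOn_exp_mul_right hl)
    ((hr.isPC hη h).integrableOn_exp_mul_right hl)

theorem IsIntegralResolvent.halfLaplace_halfConv_eq (hη : 0 < η) (h : IsPC k ℓ)
    (hr : IsIntegralResolvent η ℓ r) {l : ℝ} (hl : 0 < l) :
    halfLaplace (halfConv ℓ r) l = halfLaplace ℓ l ^ 2 / (1 + η * halfLaplace ℓ l) := by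
  rw [halfLaplace_halfConv (h.integrableOn_exp_mul_right hl)
    ((hr.isPC hη h).integrableOn_exp_mul_right hl)]
  have h0 : 0 ≤ halfLaplace ℓ l := halfLaplace_nonneg h.right_nonneg l
  have hden : 0 < 1 + η * halfLaplace ℓ l := by positivity
  rw [eq_div_iff hden.ne']
  linear_combination halfLaplace ℓ l * hr.halfLaplace_eq hη h hl

theorem tendsto_mul_const_nhdsGT_zero {x : ℝ} (hx : 0 < x) :
    Tendsto (fun l : ℝ => l * x) (𝓝[>] 0) (𝓝[>] 0) := by
  apply tendsto_nhdsWithin_of_tendsto_nhds_of_eventually_within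
  · have : ContinuousAt (fun l : ℝ => l * x) 0 := by fun_prop
    have h := this.tendsto
    rw [zero_mul] at h
    exact tendsto_nhdsWithin_of_tendsto_nhds h
  · filter_upwards [self_mem_nhdsWithin] with l hl
    exact mul_pos hl hx

theorem varianceFunction_eq (ν t : ℝ) :
    varianceFunction ν ℓ r t = 2 * ν * ∫ s in (0 : ℝ)..t, halfConv ℓ r s := by
  rw [varianceFunction, one_halfConv]

theorem isEquivalent_varianceFunction_zero {ν ρ : ℝ} (hη : 0 < η) (hν : 0 < ν) (h : IsPC k ℓ)
    (hr : IsIntegralResolvent η ℓ r) (hρ : ρ < 1 / 2) (hrv : IsRegularlyVarying (halfLaplace ℓ) ρ) :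
    (fun t => varianceFunction ν ℓ r t) ~[𝓝[>] 0]
      (fun t => 2 * ν / Real.Gamma (1 - 2 * ρ) * (halfLaplace ℓ t⁻¹) ^ 2) := by
  have hG : 0 < Real.Gamma (1 - 2 * ρ) := Real.Gamma_pos_of_pos (by linarith)
  have hden : ∀ l, 0 < l → 0 < 1 + η * halfLaplace ℓ l := fun l hl => by
    have := hrv.1 l hl
    positivity
  have hlim : Tendsto (fun l => (∫ t in (0 : ℝ)..l⁻¹, halfConv ℓ r t) / halfLaplace ℓ l ^ 2) atTop
      (𝓝 (1 / Real.Gamma (1 + -(2 * ρ)))) := by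
    refine tendsto_primitive_div_of_halfLaplace_asymp (F := atTop)
      (h := fun l => halfLaplace ℓ l ^ 2) (hr.locallyIntegrableOn_halfConv h)
      (hr.halfConv_nonneg hη h) (fun l hl => hr.integrableOn_exp_mul_halfConv hη h hl)
      (fun l hl => ?_) (fun l hl => pow_pos (hrv.1 l hl) 2) one_pos (eventually_gt_atTop 0)
      (fun x hx => tendsto_id.atTop_mul_const hx) ?_ (fun x hx => ?_)
    · rw [hr.halfLaplace_halfConv_eq hη h hl]
      exact div_pos (pow_pos (hrv.1 l hl) 2) (hden l hl)
    · have h1 : Tendsto (fun l => 1 / (1 + η * halfLaplace ℓ l)) atTop (𝓝 (1 / (1 + η * 0))) := by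
        apply tendsto_const_nhds.div
        · exact ((halfLaplace_tendsto_zero (h.integrableOn_exp_mul_right one_pos)).const_mul
            η).const_add 1
        · simp
      rw [mul_zero, add_zero, div_one] at h1
      refine h1.congr' ?_
      filter_upwards [eventually_gt_atTop 0] with l hl
      rw [hr.halfLaplace_halfConv_eq hη h hl]
      have e1 := (hden l hl).ne'
      have e2 := (hrv.1 l hl).ne'
      field_simp
    · have h1 := (hrv.2 x hx).pow 2
      rw [← Real.rpow_natCast, ← Real.rpow_mul hx.le] at h1
      have h2 : ρ * ((2 : ℕ) : ℝ) = - -(2 * ρ) := by push_cast; ring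
      rw [h2] at h1
      simpa only [div_pow] using h1
  have hlim' := (hlim.comp tendsto_inv_nhdsGT_zero).const_mul (Real.Gamma (1 - 2 * ρ))
  rw [← sub_eq_add_neg, mul_one_div_cancel hG.ne'] at hlim'
  apply isEquivalent_of_tendsto_one
  refine hlim'.congr' ?_
  filter_upwards [self_mem_nhdsWithin] with t ht
  have e := (hrv.1 t⁻¹ (inv_pos.2 ht)).ne'
  simp only [Function.comp_apply, inv_inv, Pi.div_apply, varianceFunction_eq]
  field_simp

theorem isEquivalent_varianceFunction_atTop {ν ρ : ℝ} (hη : 0 < η) (hν : 0 < ν) (h : IsPC k ℓ)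
    (hr : IsIntegralResolvent η ℓ r) (hρ : -1 < ρ)
    (hrv : IsRegularlyVarying (fun t => halfLaplace ℓ t⁻¹) ρ) (hnot : ¬ IntegrableOn ℓ (Ioi 0)) :
    (fun t => varianceFunction ν ℓ r t) ~[atTop]
      (fun t => 2 * ν / (η * Real.Gamma (1 + ρ)) * halfLaplace ℓ t⁻¹) := by
  have hG : 0 < Real.Gamma (1 + ρ) := Real.Gamma_pos_of_pos (by linarith)
  have hpos : ∀ l, 0 < l → 0 < halfLaplace ℓ l := fun l hl => by
    simpa using hrv.1 l⁻¹ (inv_pos.2 hl)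
  have hden : ∀ l, 0 < l → 0 < 1 + η * halfLaplace ℓ l := fun l hl => by
    have := hpos l hl
    positivity
  have hlim : Tendsto (fun l => (∫ t in (0 : ℝ)..l⁻¹, halfConv ℓ r t) / halfLaplace ℓ l) (𝓝[>] 0)
      (𝓝 (η⁻¹ / Real.Gamma (1 + ρ))) := by
    refine tendsto_primitive_div_of_halfLaplace_asymp (F := 𝓝[>] 0)
      (hr.locallyIntegrableOn_halfConv h)
      (hr.halfConv_nonneg hη h) (fun l hl => hr.integrableOn_exp_mul_halfConv hη h hl)
      (fun l hl => ?_) hpos (inv_pos.2 hη) self_mem_nhdsWithin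
      (fun x hx => tendsto_mul_const_nhdsGT_zero hx) ?_ (fun x hx => ?_)
    · rw [hr.halfLaplace_halfConv_eq hη h hl]
      exact div_pos (pow_pos (hpos l hl) 2) (hden l hl)
    · have htop := tendsto_halfLaplace_atTop_of_not_integrable h.locallyIntegrable_right
        h.right_nonneg (fun l hl => h.integrableOn_exp_mul_right hl) hnot
      have h1 := ((tendsto_inv_atTop_zero.comp htop).add_const η).inv₀ (by simpa using hη.ne')
      rw [zero_add] at h1
      refine h1.congr' ?_
      filter_upwards [self_mem_nhdsWithin] with l hl
      rw [hr.halfLaplace_halfConv_eq hη h hl]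
      have e1 := (hden l hl).ne'
      have e2 := (hpos l hl).ne'
      simp only [Function.comp_apply]
      field_simp
    · have h1 := (hrv.2 x⁻¹ (inv_pos.2 hx)).comp tendsto_inv_nhdsGT_zero
      rw [Real.inv_rpow hx.le, ← Real.rpow_neg hx.le] at h1
      refine h1.congr fun l => ?_
      simp [mul_comm]
  have hlim' := (hlim.comp tendsto_inv_atTop_nhdsGT_zero).const_mul (η * Real.Gamma (1 + ρ))
  have e : η * Real.Gamma (1 + ρ) * (η⁻¹ / Real.Gamma (1 + ρ)) = 1 := by field_simp
  rw [e] at hlim'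
  apply isEquivalent_of_tendsto_one
  refine hlim'.congr' ?_
  filter_upwards [eventually_gt_atTop 0] with t ht
  have e := (hpos t⁻¹ (inv_pos.2 ht)).ne'
  simp only [Function.comp_apply, inv_inv, Pi.div_apply, varianceFunction_eq]
  field_simp

end Resolvent

theorem locallyIntegrableOn_of_continuousOn_bounded {g : ℝ → ℝ} (hg : ContinuousOn g (Ioi 0))
    {C : ℝ} (hC : ∀ t, 0 < t → |g t| ≤ C) : LocallyIntegrableOn g (Ici 0) := by
  rw [locallyIntegrableOn_Ici_zero_iff]
  intro T
  refine Integrable.of_bound (C := C) ?_ ?_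
  · exact (hg.mono Ioo_subset_Ioi_self).aestronglyMeasurable measurableSet_Ioo
  · filter_upwards [ae_restrict_mem measurableSet_Ioo] with t ht
    exact hC t ht.1

/-- Solving `(κ ∗ (k ∗ w)) = ν (1 ∗ 1 ∗ m)` for `w`, where `κ = k + η`. -/
theorem eq_halfConv_of_telegraph {k ℓ r w m : ℝ → ℝ} {η ν C : ℝ} (hη : 0 < η) (h : IsPC k ℓ)
    (hr : IsIntegralResolvent η ℓ r) (hw : ContinuousOn w (Ioi 0)) (hwC : ∀ t, 0 < t → |w t| ≤ C)
    (hm : ContinuousOn m (Ioi 0)) (hmC : ∀ t, 0 < t → |m t| ≤ C)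
    (heq : ∀ t, 0 < t → halfConv k (halfConv k w) t + η * halfConv (fun _ => 1) (halfConv k w) t
      = ν * halfConv (fun _ => 1) (halfConv (fun _ => 1) m) t) {t : ℝ} (ht : 0 < t) :
    w t = ν * halfConv (halfConv ℓ r) m t := by
  have hk := h.locallyIntegrable_left
  have hl := h.locallyIntegrable_right
  have hrl := hr.locallyIntegrable
  have hPC := hr.isPC hη h
  have hwl := locallyIntegrableOn_of_continuousOn_bounded hw hwC
  have hml := locallyIntegrableOn_of_continuousOn_bounded hm hmC
  have one := locallyIntegrableOn_const_halfLine 1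
  have hkw := locallyIntegrableOn_halfConv hk hwl
  have smul : ∀ {f : ℝ → ℝ}, LocallyIntegrableOn f (Ici 0) →
      LocallyIntegrableOn (fun s => ν * f s) (Ici 0) := fun hf x hx => by
    obtain ⟨s, hs, h⟩ := hf x hx
    exact ⟨s, hs, h.const_mul ν⟩
  have h1m := locallyIntegrableOn_halfConv one hml
  have hrm := locallyIntegrableOn_halfConv hrl hml
  have smulConv : ∀ f g : ℝ → ℝ, halfConv f (fun s => ν * g s) = fun t => ν * halfConv f g t :=
    fun f g => funext fun t => halfConv_const_mul_right _ _ _ _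
  have step1 : halfConv k w =ᵐ[vol₊] halfConv r (fun s => ν * halfConv (fun _ => 1) m s) := by
    apply ae_eq_halfConv_of_conv_eq_one hPC.locallyIntegrable_left hrl hkw (smul h1m)
      hPC.conv_eq_one
    filter_upwards [halfConv_add_left hkw hk (locallyIntegrableOn_const_halfLine η),
      ae_restrict_mem measurableSet_Ioi] with t e1 h0
    have e7 : halfConv (fun _ => η) (halfConv k w) t
        = η * halfConv (fun _ => 1) (halfConv k w) t := by
      rw [← halfConv_const_mul_left]; simp
    rw [e1, e7, smulConv, heq t h0]
  have step2 : w =ᵐ[vol₊] halfConv ℓ (fun s => ν * halfConv r m s) := by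
    apply ae_eq_halfConv_of_conv_eq_one hk hl hwl (smul hrm) h.conv_eq_one
    filter_upwards [step1, halfConv_assoc hrl one hml, halfConv_assoc one hrl hml] with t e1 e2 e3
    have e4 : halfConv r (fun _ => 1) = halfConv (fun _ => 1) r := funext fun s =>
      halfConv_comm _ _ _
    rw [e1, smulConv, smulConv]
    simp only
    rw [← e2, e4, e3]
  have hlr := locallyIntegrableOn_halfConv hl hrl
  have step3 : w =ᵐ[vol₊] fun t => ν * halfConv (halfConv ℓ r) m t := by
    filter_upwards [step2, halfConv_assoc hl hrl hml] with t e1 e2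
    rw [e1, smulConv, e2]
  refine continuousOn_eq_of_ae_eq hw ?_ step3 ht
  intro t ht
  exact (continuousAt_const.mul (halfConv_continuousAt hlr hm ht
    fun s hs _ => hmC s hs)).continuousWithinAt

section Densities

variable {Ω : Type*} [MeasurableSpace Ω] {P : Measure Ω} {X : ℝ → Ω → ℝ} {U : ℝ → ℝ → ℝ}

theorem HasDensities.spacePairing_eq (hX : HasDensities P X U) {t : ℝ} (ht : 0 < t)
    (hU : Integrable (U t)) {φ : ℝ → ℝ} (hφ : Continuous φ) :
    spacePairing U φ t = ∫ o, φ (X t o) ∂P := by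
  rw [← integral_map (hX.aemeasurable t ht) hφ.aestronglyMeasurable, hX.law t ht,
    integral_withDensity_eq_integral_toReal_smul₀ hU.aemeasurable.ennreal_ofReal
    (ae_of_all _ fun s => ENNReal.ofReal_lt_top), spacePairing]
  apply integral_congr_ae
  filter_upwards [hX.nonneg t ht] with z hz
  rw [ENNReal.toReal_ofReal hz, smul_eq_mul, mul_comm]

theorem abs_integral_comp_le [IsProbabilityMeasure P] {Y : Ω → ℝ} {φ : ℝ → ℝ} {C : ℝ}
    (hC : ∀ z, |φ z| ≤ C) : |∫ o, φ (Y o) ∂P| ≤ C := by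
  have := norm_integral_le_of_norm_le_const (μ := P) (f := fun o => φ (Y o)) (C := C)
    (ae_of_all _ fun o => hC _)
  simpa using this

theorem exists_bound_of_hasCompactSupport {φ : ℝ → ℝ} (hφ : Continuous φ)
    (hs : HasCompactSupport φ) : ∃ C, ∀ z, |φ z| ≤ C :=
  hφ.bounded_above_of_compact_support hs

/-- Evolution of the expectation of a test function. -/
theorem IsFundamentalSolution.integral_comp_eq [IsProbabilityMeasure P] {k ℓ r : ℝ → ℝ} {η ν : ℝ}
    (hη : 0 < η) (h : IsPC k ℓ) (hr : IsIntegralResolvent η ℓ r)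
    (hU : IsFundamentalSolution k η ν U) (hX : HasDensities P X U) {φ : ℝ → ℝ}
    (hφ : ContDiff ℝ ∞ φ) (hs : HasCompactSupport φ) {t : ℝ} (ht : 0 < t) :
    ∫ o, φ (X t o) ∂P - φ 0
      = ν * halfConv (halfConv ℓ r) (fun s => ∫ o, deriv (deriv φ) (X s o) ∂P) t := by
  have hφ1 : ContDiff ℝ ∞ (deriv φ) := hφ.deriv'
  have hφ2 : ContDiff ℝ ∞ (deriv (deriv φ)) := hφ1.deriv'
  have hs2 : HasCompactSupport (deriv (deriv φ)) := hs.deriv.deriv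
  obtain ⟨C₁, hC₁⟩ := exists_bound_of_hasCompactSupport hφ.continuous hs
  obtain ⟨C₂, hC₂⟩ := exists_bound_of_hasCompactSupport hφ2.continuous hs2
  have hp : ∀ s, 0 < s → spacePairing U φ s = ∫ o, φ (X s o) ∂P := fun s hs =>
    hX.spacePairing_eq hs (hU.integrable s hs) hφ.continuous
  have hp2 : ∀ s, 0 < s → spacePairing U (deriv (deriv φ)) s = ∫ o, deriv (deriv φ) (X s o) ∂P :=
    fun s hs => hX.spacePairing_eq hs (hU.integrable s hs) hφ2.continuous
  have key := eq_halfConv_of_telegraph (C := max (C₁ + |φ 0|) C₂) hη h hr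
    ((hU.continuousOn φ hφ hs).sub continuousOn_const) (fun s hs => ?_)
    (hU.continuousOn _ hφ2 hs2) (fun s hs => ?_) (hU.equation φ hφ hs) ht
  · rw [← hp t ht]
    refine key.trans ?_
    congr 1
    apply halfConv_congr_right _ ht.le
    filter_upwards [ae_restrict_mem measurableSet_Ioi] with s hs using hp2 s hs
  · rw [Pi.sub_apply, hp s hs]
    refine le_max_of_le_left ((abs_sub _ _).trans ?_)
    gcongr
    exact abs_integral_comp_le hC₁
  · rw [hp2 s hs]
    exact le_max_of_le_right (abs_integral_comp_le hC₂)

theorem deriv_deriv_scaled (φ : ℝ → ℝ) (A c : ℝ) :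
    deriv (deriv fun z => A * φ (c * z)) = fun z => A * c ^ 2 * deriv (deriv φ) (c * z) := by
  have h1 : deriv (fun z => A * φ (c * z)) = fun z => (A * c) * deriv φ (c * z) := by
    ext z
    rw [deriv_const_mul_field, deriv_comp_mul_left, smul_eq_mul, mul_assoc]
  rw [h1]
  ext z
  rw [deriv_const_mul_field, deriv_comp_mul_left, smul_eq_mul]
  ring

theorem tendsto_halfConv_of_dominated {f : ℝ → ℝ} (hf : LocallyIntegrableOn f (Ici 0))
    {g : ℕ → ℝ → ℝ} {g' : ℝ → ℝ} {C : ℝ} (hg : ∀ n, ContinuousOn (g n) (Ioi 0))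
    (hC : ∀ n t, 0 < t → |g n t| ≤ C) (hlim : ∀ t, 0 < t → Tendsto (fun n => g n t) atTop (𝓝 (g' t)))
    {t : ℝ} (ht : 0 ≤ t) :
    Tendsto (fun n => halfConv f (g n) t) atTop (𝓝 (halfConv f g' t)) := by
  simp_rw [halfConv_comm f, halfConv_eq_setIntegral _ _ ht]
  have hfi := locallyIntegrableOn_Ici_zero_iff.1 hf t
  apply tendsto_integral_of_dominated_convergence (fun s => C * |f s|)
  · intro n
    refine AEStronglyMeasurable.mul ?_ hfi.aestronglyMeasurable
    refine ContinuousOn.aestronglyMeasurable ?_ measurableSet_Ioo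
    exact (hg n).comp (by fun_prop) fun s hs => sub_pos.2 hs.2
  · exact hfi.abs.const_mul C
  · intro n
    filter_upwards [ae_restrict_mem measurableSet_Ioo] with s hs
    rw [norm_mul, Real.norm_eq_abs, Real.norm_eq_abs]
    gcongr
    exact hC n _ (sub_pos.2 hs.2)
  · filter_upwards [ae_restrict_mem measurableSet_Ioo] with s hs
    exact (hlim _ (sub_pos.2 hs.2)).mul_const _

theorem tendsto_integral_comp_inv_mul [IsProbabilityMeasure P] {Y : Ω → ℝ} (hY : AEMeasurable Y P)
    {φ : ℝ → ℝ} (hφ : Continuous φ) {C : ℝ} (hC : ∀ z, |φ z| ≤ C) :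
    Tendsto (fun n : ℕ => ∫ o, φ (((n : ℝ) + 1)⁻¹ * Y o) ∂P) atTop (𝓝 (φ 0)) := by
  have h0 : φ 0 = ∫ _, φ 0 ∂P := by simp
  rw [h0]
  apply tendsto_integral_of_dominated_convergence (fun _ => C)
  · intro n
    exact hφ.aestronglyMeasurable.comp_aemeasurable (hY.const_mul _)
  · exact integrable_const C
  · exact fun n => ae_of_all _ fun o => hC _
  · refine ae_of_all _ fun o => ?_
    have h1 : Tendsto (fun n : ℕ => ((n : ℝ) + 1)⁻¹ * Y o) atTop (𝓝 (0 * Y o)) :=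
      (tendsto_inv_atTop_zero.comp (tendsto_natCast_atTop_atTop.atTop_add
        (tendsto_const_nhds (x := (1 : ℝ))))).mul_const _
    rw [zero_mul] at h1
    exact (hφ.tendsto 0).comp h1

theorem IsFundamentalSolution.tendsto_scaled [IsProbabilityMeasure P] {k ℓ r : ℝ → ℝ} {η ν : ℝ}
    (hη : 0 < η) (h : IsPC k ℓ) (hr : IsIntegralResolvent η ℓ r)
    (hU : IsFundamentalSolution k η ν U) (hX : HasDensities P X U) {φ : ℝ → ℝ}
    (hφ : ContDiff ℝ ∞ φ) (hs : HasCompactSupport φ) (h0 : φ 0 = 0) {t : ℝ} (ht : 0 < t) :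
    Tendsto (fun n : ℕ => ∫ o, ((n : ℝ) + 1) ^ 2 * φ (((n : ℝ) + 1)⁻¹ * X t o) ∂P) atTop
      (𝓝 (ν * (deriv (deriv φ) 0 * ∫ s in (0 : ℝ)..t, halfConv ℓ r s))) := by
  have hφ1 : ContDiff ℝ ∞ (deriv φ) := hφ.deriv'
  have hφ2 : ContDiff ℝ ∞ (deriv (deriv φ)) := hφ1.deriv'
  obtain ⟨C, hC⟩ := exists_bound_of_hasCompactSupport hφ2.continuous hs.deriv.deriv
  have hn : ∀ n : ℕ, ((n : ℝ) + 1) ≠ 0 := fun n => by positivity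
  have hφn : ∀ n : ℕ, ContDiff ℝ ∞ fun z => ((n : ℝ) + 1) ^ 2 * φ (((n : ℝ) + 1)⁻¹ * z) := fun n =>
    contDiff_const.mul (hφ.comp (contDiff_const.mul contDiff_id))
  have hsn : ∀ n : ℕ, HasCompactSupport fun z => ((n : ℝ) + 1) ^ 2 * φ (((n : ℝ) + 1)⁻¹ * z) :=
    fun n => (hs.comp_homeomorph (Homeomorph.mulLeft₀ _ (inv_ne_zero (hn n)))).mul_left
  have hdd : ∀ n : ℕ, deriv (deriv fun z => ((n : ℝ) + 1) ^ 2 * φ (((n : ℝ) + 1)⁻¹ * z))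
      = fun z => deriv (deriv φ) (((n : ℝ) + 1)⁻¹ * z) := by
    intro n
    rw [deriv_deriv_scaled]
    have : ((n : ℝ) + 1) ^ 2 * (((n : ℝ) + 1)⁻¹) ^ 2 = 1 := by
      rw [← mul_pow, mul_inv_cancel₀ (hn n), one_pow]
    simp_rw [this, one_mul]
  have hlr := hr.locallyIntegrableOn_halfConv h
  have heq : ∀ n : ℕ, ∫ o, ((n : ℝ) + 1) ^ 2 * φ (((n : ℝ) + 1)⁻¹ * X t o) ∂P
      = ν * halfConv (halfConv ℓ r)
        (fun s => ∫ o, deriv (deriv φ) (((n : ℝ) + 1)⁻¹ * X s o) ∂P) t := by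
    intro n
    have := hU.integral_comp_eq hη h hr hX (hφn n) (hsn n) ht
    rw [hdd] at this
    simpa only [mul_zero, h0, sub_zero] using this
  simp_rw [heq]
  have hval : halfConv (halfConv ℓ r) (fun _ => deriv (deriv φ) 0) t
      = deriv (deriv φ) 0 * ∫ s in (0 : ℝ)..t, halfConv ℓ r s := by
    rw [← one_halfConv, halfConv_comm, ← halfConv_const_mul_left]
    simp
  rw [← hval]
  apply Tendsto.const_mul
  refine tendsto_halfConv_of_dominated hlr (C := C) (fun n => ?_) (fun n s hs => ?_)
    (fun s hs => ?_) ht.le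
  · have hφn2 : ContDiff ℝ ∞ fun z => deriv (deriv φ) (((n : ℝ) + 1)⁻¹ * z) :=
      hφ2.comp (contDiff_const.mul contDiff_id)
    have hsn2 : HasCompactSupport fun z => deriv (deriv φ) (((n : ℝ) + 1)⁻¹ * z) :=
      hs.deriv.deriv.comp_homeomorph (Homeomorph.mulLeft₀ _ (inv_ne_zero (hn n)))
    refine (hU.continuousOn _ hφn2 hsn2).congr fun s hs => ?_
    exact (hX.spacePairing_eq hs (hU.integrable s hs) hφn2.continuous).symm
  · exact abs_integral_comp_le (φ := fun z => deriv (deriv φ) (((n : ℝ) + 1)⁻¹ * z))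
      fun z => hC _
  · exact tendsto_integral_comp_inv_mul (hX.aemeasurable s hs) hφ2.continuous hC

end Densities

section Moments

variable {Ω : Type*} [MeasurableSpace Ω] {P : Measure Ω} {X : ℝ → Ω → ℝ} {U : ℝ → ℝ → ℝ}

theorem deriv_deriv_sq_mul_bump (β : ContDiffBump (0 : ℝ)) :
    deriv (deriv fun z => z ^ 2 * β z) 0 = 2 := by
  have h1 : (fun z => z ^ 2 * β z) =ᶠ[𝓝 0] fun z : ℝ => z ^ 2 := by
    filter_upwards [β.eventuallyEq_one] with z hz
    rw [hz, Pi.one_apply, mul_one]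
  rw [h1.deriv.deriv_eq]
  have h2 : deriv (fun z : ℝ => z ^ 2) = fun z => 2 * z := by
    ext z; simp
  rw [h2, deriv_const_mul_field]
  simp

theorem tendsto_bump_scaled (β : ContDiffBump (0 : ℝ)) (x : ℝ) :
    Tendsto (fun n : ℕ => β (((n : ℝ) + 1)⁻¹ * x)) atTop (𝓝 1) := by
  have h1 : Tendsto (fun n : ℕ => ((n : ℝ) + 1)⁻¹ * x) atTop (𝓝 (0 * x)) :=
    (tendsto_inv_atTop_zero.comp (tendsto_natCast_atTop_atTop.atTop_add
      (tendsto_const_nhds (x := (1 : ℝ))))).mul_const _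
  rw [zero_mul] at h1
  have h2 := (β.continuous.tendsto 0).comp h1
  rwa [β.eventuallyEq_one.eq_of_nhds] at h2

/-- Second moment from truncated second moments. -/
theorem integrable_sq_of_tendsto {Y : Ω → ℝ} (hY : AEMeasurable Y P) (β : ContDiffBump (0 : ℝ))
    [IsProbabilityMeasure P] {v : ℝ}
    (hv : Tendsto (fun n : ℕ => ∫ o, Y o ^ 2 * β (((n : ℝ) + 1)⁻¹ * Y o) ∂P) atTop (𝓝 v)) :
    Integrable (fun o => Y o ^ 2) P := by
  have hβ : Continuous β := β.continuous
  have hmeas : ∀ n : ℕ, AEStronglyMeasurable (fun o => Y o ^ 2 * β (((n : ℝ) + 1)⁻¹ * Y o)) P := by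
    intro n
    exact (by fun_prop : Continuous fun z : ℝ => z ^ 2 * β (((n : ℝ) + 1)⁻¹ * z))
      |>.aestronglyMeasurable.comp_aemeasurable hY
  have hint : ∀ n : ℕ, Integrable (fun o => Y o ^ 2 * β (((n : ℝ) + 1)⁻¹ * Y o)) P := by
    intro n
    refine Integrable.of_bound (hmeas n) ((((n : ℝ) + 1) * β.rOut) ^ 2) (ae_of_all _ fun o => ?_)
    have hn : (0 : ℝ) < (n : ℝ) + 1 := by positivity
    rw [Real.norm_of_nonneg (mul_nonneg (sq_nonneg _) β.nonneg)]
    by_cases hz : |((n : ℝ) + 1)⁻¹ * Y o| < β.rOut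
    · rw [abs_mul, abs_of_pos (inv_pos.2 hn), inv_mul_lt_iff₀ hn] at hz
      calc Y o ^ 2 * β (((n : ℝ) + 1)⁻¹ * Y o) ≤ Y o ^ 2 * 1 := by
            gcongr
            exact β.le_one
        _ = |Y o| ^ 2 := by rw [mul_one, sq_abs]
        _ ≤ _ := by gcongr
    · rw [β.zero_of_le_dist (by simpa [Real.dist_eq] using not_lt.1 hz), mul_zero]
      positivity
  have hlim : ∀ o, Tendsto (fun n : ℕ => Y o ^ 2 * β (((n : ℝ) + 1)⁻¹ * Y o)) atTop
      (𝓝 (Y o ^ 2)) := fun o => by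
    simpa using (tendsto_bump_scaled β (Y o)).const_mul (Y o ^ 2)
  refine ⟨(hY.pow_const 2).aestronglyMeasurable, lt_of_le_of_lt
    (lintegral_congr_ae (ae_of_all _ fun o => ((hlim o).enorm.liminf_eq).symm) |>.le.trans
      (lintegral_liminf_le' fun n => (hmeas n).aemeasurable.enorm)) (Ne.lt_top ?_)⟩
  · have e : ∀ n : ℕ, ∫⁻ o, ‖Y o ^ 2 * β (((n : ℝ) + 1)⁻¹ * Y o)‖ₑ ∂P
        = ENNReal.ofReal (∫ o, Y o ^ 2 * β (((n : ℝ) + 1)⁻¹ * Y o) ∂P) := by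
      intro n
      rw [ofReal_integral_eq_lintegral_ofReal (hint n)
        (ae_of_all _ fun o => mul_nonneg (sq_nonneg _) β.nonneg)]
      refine lintegral_congr fun o => ?_
      rw [Real.enorm_of_nonneg (mul_nonneg (sq_nonneg _) β.nonneg)]
    simp_rw [e]
    rw [(ENNReal.tendsto_ofReal hv).liminf_eq]
    exact ENNReal.ofReal_ne_top

theorem tendsto_integral_mul_bump {Y g : Ω → ℝ} (hY : AEMeasurable Y P) (hg : Integrable g P)
    (β : ContDiffBump (0 : ℝ)) :
    Tendsto (fun n : ℕ => ∫ o, g o * β (((n : ℝ) + 1)⁻¹ * Y o) ∂P) atTop (𝓝 (∫ o, g o ∂P)) := by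
  apply tendsto_integral_of_dominated_convergence (fun o => ‖g o‖)
  · exact fun n => hg.aestronglyMeasurable.mul
      (β.continuous.aestronglyMeasurable.comp_aemeasurable (hY.const_mul _))
  · exact hg.norm
  · refine fun n => ae_of_all _ fun o => ?_
    rw [norm_mul, Real.norm_of_nonneg (r := β _) β.nonneg]
    exact mul_le_of_le_one_right (norm_nonneg _) β.le_one
  · refine ae_of_all _ fun o => ?_
    simpa using (tendsto_bump_scaled β (Y o)).const_mul (g o)

theorem IsFundamentalSolution.memLp_and_variance_eq [IsProbabilityMeasure P] {k ℓ r : ℝ → ℝ}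
    {η ν : ℝ} (hη : 0 < η) (h : IsPC k ℓ) (hr : IsIntegralResolvent η ℓ r)
    (hU : IsFundamentalSolution k η ν U) (hX : HasDensities P X U) {t : ℝ} (ht : 0 < t) :
    MemLp (X t) 2 P ∧ variance (X t) P = varianceFunction ν ℓ r t := by
  have hY := hX.aemeasurable t ht
  let β : ContDiffBump (0 : ℝ) := ⟨1, 2, one_pos, one_lt_two⟩
  have hβ : ContDiff ℝ ∞ β := β.contDiff
  have hn : ∀ n : ℕ, ((n : ℝ) + 1) ≠ 0 := fun n => by positivity
  have h2 := hU.tendsto_scaled hη h hr hX (φ := fun z => z ^ 2 * β z)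
    ((contDiff_id.pow 2).mul hβ) β.hasCompactSupport.mul_left (by simp) ht
  have e2 : ∀ (n : ℕ) (x : ℝ), ((n : ℝ) + 1) ^ 2 *
      ((((n : ℝ) + 1)⁻¹ * x) ^ 2 * β (((n : ℝ) + 1)⁻¹ * x))
      = x ^ 2 * β (((n : ℝ) + 1)⁻¹ * x) := by
    intro n x
    have := hn n
    rw [← mul_assoc]
    congr 1
    field_simp
  simp_rw [e2, deriv_deriv_sq_mul_bump] at h2
  have hsq := integrable_sq_of_tendsto hY β h2
  have hLp : MemLp (X t) 2 P := (memLp_two_iff_integrable_sq hY.aestronglyMeasurable).2 hsq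
  have hmom2 := tendsto_nhds_unique (tendsto_integral_mul_bump hY hsq β) h2
  have hXint : Integrable (X t) P := hLp.integrable one_le_two
  have h1 := hU.tendsto_scaled hη h hr hX (φ := fun z => z * β z)
    (contDiff_id.mul hβ) β.hasCompactSupport.mul_left (by simp) ht
  have h1' := (tendsto_inv_atTop_zero.comp (tendsto_natCast_atTop_atTop.atTop_add
      (tendsto_const_nhds (x := (1 : ℝ))))).mul h1
  rw [zero_mul] at h1'
  have e1 : ∀ n : ℕ, ((n : ℝ) + 1)⁻¹ * ∫ o, ((n : ℝ) + 1) ^ 2 *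
      ((((n : ℝ) + 1)⁻¹ * X t o) * β (((n : ℝ) + 1)⁻¹ * X t o)) ∂P
      = ∫ o, X t o * β (((n : ℝ) + 1)⁻¹ * X t o) ∂P := by
    intro n
    rw [← integral_const_mul]
    refine integral_congr_ae (ae_of_all _ fun o => ?_)
    have := hn n
    simp only
    rw [← mul_assoc, ← mul_assoc]
    congr 1
    field_simp
  simp only [Function.comp_apply, e1] at h1'
  have hmean := tendsto_nhds_unique (tendsto_integral_mul_bump hY hXint β) h1'
  refine ⟨hLp, ?_⟩
  rw [variance_eq_sub hLp, hmean, varianceFunction_eq]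
  simp only [Pi.pow_apply]
  rw [hmom2]
  ring

end Moments

end

theorem mainTheorem1 (k ℓ r : ℝ → ℝ) (η ν : ℝ) (hη : 0 < η) (hν : 0 < ν)
    (hPC : IsPC k ℓ) (hr : IsIntegralResolvent η ℓ r) :
    -- the variance of the process is `2 ν (1 ∗ ℓ ∗ r)`
    (∀ {Ω : Type*} [MeasurableSpace Ω] (P : Measure Ω) [IsProbabilityMeasure P]
        (X : ℝ → Ω → ℝ) (U : ℝ → ℝ → ℝ),
        IsFundamentalSolution k η ν U → HasDensities P X U →
        ∀ t, 0 < t → MemLp (X t) 2 P ∧ variance (X t) P = varianceFunction ν ℓ r t) ∧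
    -- behaviour at `0⁺`
    (∀ ρ₁ : ℝ, ρ₁ < 1 / 2 → IsRegularlyVarying (halfLaplace ℓ) ρ₁ →
        (fun t => varianceFunction ν ℓ r t) ~[𝓝[>] 0]
          (fun t => 2 * ν / Real.Gamma (1 - 2 * ρ₁) * (halfLaplace ℓ t⁻¹) ^ 2)) ∧
    -- behaviour at infinity
    (∀ ρ₂ : ℝ, -1 < ρ₂ → IsRegularlyVarying (fun t => halfLaplace ℓ t⁻¹) ρ₂ →
        ¬ IntegrableOn ℓ (Ioi 0) →
        (fun t => varianceFunction ν ℓ r t) ~[atTop]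
          (fun t => 2 * ν / (η * Real.Gamma (1 + ρ₂)) * halfLaplace ℓ t⁻¹)) :=
  ⟨fun _ _ _ _ hU hX _ ht => hU.memLp_and_variance_eq hη hPC hr hX ht,
    fun _ hρ hrv => isEquivalent_varianceFunction_zero hη hν hPC hr hρ hrv,
    fun _ hρ hrv hnot => isEquivalent_varianceFunction_atTop hη hν hPC hr hρ hrv hnot⟩
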